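/- Let $X$ be a compact (Hausdorff) complex manifold with a smooth positive volume form $dV$, and let $F$ be a holomorphic line bundle on $X$ with a singular metric $h=g\,e^{-\varphi}$, where $g$ is a smooth Hermitian metric on $F$ and $\varphi$ is an $L^1$-function on $X$; thus $|v|_h=|v|_g\,e^{-\varphi}$. Assume that the curvature current $\sqrt{-1}\,\Theta_h(F):=\sqrt{-1}\,\Theta_g(F)+\sqrt{-1}\,\partial\bar\partial\varphi$ satisfies $\sqrt{-1}\,\Theta_h(F)\ge\gamma$ in the sense of currents for some smooth real $(1,1)$-form $\gamma$ on $X$. Let $\mathcal I(h)$ be the multiplier ideal sheaf of $h$, that is, for $U\subset X$ open, $$\mathcal I(h)(U)=\{f\in\mathcal O_X(U) : |f|e^{-\varphi}\in L^2_{\mathrm{loc}}(U)\}.$$ Let $\mathcal U=\{B_i\}_{i\in I}$ be a finite cover of $X$ by Stein open sets such that, for every $i$, $F$ is holomorphically trivial on $B_i$, and there are finitely many holomorphic functions on $B_i$ that generate the stalk of $\mathcal I(h)$ at every point of $B_i$. For $p\ge 0$ let $$C^p(\mathcal U,F\otimes\mathcal I(h))=\prod_{(i_0,\dots,i_p)\in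 I^{p+1}}H^0(B_{i_0\dots i_p},F\otimes\mathcal I(h)),\qquad B_{i_0\dots i_p}=B_{i_0}\cap\dots\cap B_{i_p},$$ be the space of Čech $p$-cochains; here sections of $F\otimes\mathcal I(h)$ are regarded as holomorphic sections of $F$ whose coefficients in local trivializations of $F$ belong to $\mathcal I(h)$. For every $(i_0,\dots,i_p)$ and every measurable relatively compact subset $K\Subset B_{i_0\dots i_p}$, put $$p_K(f)^2=\int_K|f_{i_0\dots i_p}|_h^2\,dV .$$ Then these $p_K$ are (finite) seminorms on $C^p(\mathcal U,F\otimes\mathcal I(h))$, and with the topology that they induce $C^p(\mathcal U,F\otimes\mathcal I(h))$ is a Fréchet space, that is, a Hausdorff, metrizable and complete locally convex topological vector space. -/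

import Mathlib

open Set MeasureTheory
open scoped Manifold ContDiff ENNReal Bundle

noncomputable section

namespace CechFrechet

/-- The model space `ℂⁿ` with its Euclidean norm and Lebesgue measure. -/
abbrev Cn (n : ℕ) : Type := EuclideanSpace ℂ (Fin n)

section Manifold

variable {n : ℕ} {X : Type*} [TopologicalSpace X] [ChartedSpace (Cn n) X]

/-- `f` is a holomorphic function on `U ⊆ X` (values of `f` outside `U` are irrelevant). -/
def HolomorphicOn (n : ℕ) {X : Type*} [TopologicalSpace X] [ChartedSpace (Cn n) X]
    (f : X → ℂ) (U : Set X) : Prop :=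
  MDifferentiableOn 𝓘(ℂ, Cn n) 𝓘(ℂ, ℂ) f U

/-- `U` is a Stein open subset of the complex manifold `X`: it is holomorphically convex,
global holomorphic functions separate its points, and they give local coordinates
at each of its points. -/
structure IsSteinOpen (n : ℕ) {X : Type*} [TopologicalSpace X] [ChartedSpace (Cn n) X]
    (U : Set X) : Prop where
  isOpen : IsOpen U
  holomorphicallyConvex : ∀ K : Set X, IsCompact K → K ⊆ U →
    IsCompact {x | x ∈ U ∧ ∀ f : X → ℂ, HolomorphicOn n f U →
      ∀ C : ℝ, (∀ y ∈ K, ‖f y‖ ≤ C) → ‖f x‖ ≤ C}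
  separatesPoints : ∀ x ∈ U, ∀ y ∈ U, x ≠ y →
    ∃ f : X → ℂ, HolomorphicOn n f U ∧ f x ≠ f y
  localCoordinates : ∀ x ∈ U, ∃ f : X → Cn n,
    MDifferentiableOn 𝓘(ℂ, Cn n) 𝓘(ℂ, Cn n) f U ∧
      Function.Bijective (mfderiv 𝓘(ℂ, Cn n) 𝓘(ℂ, Cn n) f x)

/-- `μ` is the measure of a smooth positive volume form on `X` (for example `ωⁿ` for a
Hermitian form `ω`): in each holomorphic chart it has a smooth positive density
with respect to Lebesgue measure. -/
def IsSmoothVolume (n : ℕ) {X : Type*} [TopologicalSpace X] [ChartedSpace (Cn n) X]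
    [MeasurableSpace X] (μ : Measure X) : Prop :=
  ∀ c ∈ IsManifold.maximalAtlas 𝓘(ℂ, Cn n) ω X, ∃ ρ : Cn n → ℝ,
    ContDiffOn ℝ ∞ ρ c.target ∧ (∀ z ∈ c.target, 0 < ρ z) ∧
    ∀ A : Set X, MeasurableSet A → A ⊆ c.source →
      μ A = ∫⁻ z in c.target ∩ c.symm ⁻¹' A, ENNReal.ofReal (ρ z)

/-- The image in `T_x X`, `x = c⁻¹(z)`, of the vector `ξ` under the differential of the inverse
of the chart `c`. -/
def chartVector (c : OpenPartialHomeomorph X (Cn n)) (z ξ : Cn n) :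
    TangentSpace 𝓘(ℂ, Cn n) (c.symm z) :=
  mfderiv 𝓘(ℂ, Cn n) 𝓘(ℂ, Cn n) c.symm z ξ

/-- A smooth real `(1,1)`-form `γ` on `X`, given by its smooth family of Hermitian forms on the
holomorphic tangent spaces: `γ = √-1 ∑ γ_{jk} dz_j ∧ dz̄_k` corresponds to
`γ(ξ, ξ) = ∑ γ_{jk} ξ_j ξ̄_k`. -/
structure RealOneOneForm (n : ℕ) (X : Type*) [TopologicalSpace X] [ChartedSpace (Cn n) X] where
  toFun : ∀ x : X, TangentSpace 𝓘(ℂ, Cn n) x →ₗ⋆[ℂ] TangentSpace 𝓘(ℂ, Cn n) x →ₗ[ℂ] ℂ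
  hermitian : ∀ x u v, (starRingEnd ℂ) (toFun x u v) = toFun x v u
  smooth : ∀ c ∈ IsManifold.maximalAtlas 𝓘(ℂ, Cn n) ω X, ∀ ξ η : Cn n,
    ContDiffOn ℝ ∞
      (fun z => toFun (c.symm z) (chartVector c z ξ) (chartVector c z η)) c.target

/-- The complex Hessian `∑ (∂²χ/∂z_j∂z̄_k)(z) ξ_j ξ̄_k`, which is a quarter of
the sum of the second real derivatives of `χ` in the directions `ξ` and `√-1 ξ`. -/
def complexHessian (χ : Cn n → ℝ) (z ξ : Cn n) : ℝ :=
  (1 / 4) * (fderiv ℝ (fun w => fderiv ℝ χ w ξ) z ξ +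
    fderiv ℝ (fun w => fderiv ℝ χ w (Complex.I • ξ)) z (Complex.I • ξ))

end Manifold

section LineBundle

variable {n : ℕ} {X : Type*} [TopologicalSpace X] [ChartedSpace (Cn n) X]
  {F : X → Type*} [TopologicalSpace (Bundle.TotalSpace ℂ F)] [∀ x, TopologicalSpace (F x)]
  [∀ x, AddCommGroup (F x)] [∀ x, Module ℂ (F x)] [FiberBundle ℂ F]

/-- `s` is a nowhere vanishing holomorphic section over `V`, that is, it gives a holomorphic
trivialization of the line bundle `F` over `V`. -/
def IsHolomorphicFrame (n : ℕ) {X : Type*} [TopologicalSpace X] [ChartedSpace (Cn n) X]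
    {F : X → Type*} [TopologicalSpace (Bundle.TotalSpace ℂ F)] [∀ x, TopologicalSpace (F x)]
    [∀ x, AddCommGroup (F x)] [∀ x, Module ℂ (F x)] [FiberBundle ℂ F]
    (s : ∀ x, F x) (V : Set X) : Prop :=
  MDifferentiableOn 𝓘(ℂ, Cn n) (𝓘(ℂ, Cn n).prod 𝓘(ℂ, ℂ))
    (fun x => Bundle.TotalSpace.mk' ℂ x (s x)) V ∧ ∀ x ∈ V, s x ≠ 0

/-- A smooth Hermitian metric on the line bundle `F`, given by its norm on each fibre (on a
one-dimensional space, these norms are exactly those of the Hermitian inner products). -/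
structure HermitianMetric (n : ℕ) {X : Type*} [TopologicalSpace X] [ChartedSpace (Cn n) X]
    (F : X → Type*) [TopologicalSpace (Bundle.TotalSpace ℂ F)] [∀ x, TopologicalSpace (F x)]
    [∀ x, AddCommGroup (F x)] [∀ x, Module ℂ (F x)] [FiberBundle ℂ F] where
  nrm : ∀ x, F x → ℝ
  nrm_pos : ∀ x (v : F x), v ≠ 0 → 0 < nrm x v
  nrm_smul : ∀ x (a : ℂ) (v : F x), nrm x (a • v) = ‖a‖ * nrm x v
  smooth : ∀ (V : Set X) (s : ∀ x, F x), IsOpen V → IsHolomorphicFrame n s V →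
    ContMDiffOn 𝓘(ℝ, Cn n) 𝓘(ℝ, ℝ) ∞ (fun x => nrm x (s x)) V

/-- A singular metric `h = g e^{-φ}` on `F`, with `g` smooth and `φ` an `L¹`-function, which
may take the values `±∞` on a null set. -/
structure SingularMetric (n : ℕ) {X : Type*} [TopologicalSpace X] [ChartedSpace (Cn n) X]
    (F : X → Type*) [TopologicalSpace (Bundle.TotalSpace ℂ F)] [∀ x, TopologicalSpace (F x)]
    [∀ x, AddCommGroup (F x)] [∀ x, Module ℂ (F x)] [FiberBundle ℂ F]
    [MeasurableSpace X] (μ : Measure X) where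
  g : HermitianMetric n F
  φ : X → EReal
  ae_finite : ∀ᵐ x ∂μ, φ x ≠ ⊤ ∧ φ x ≠ ⊥
  integrable : Integrable (fun x => (φ x).toReal) μ

namespace SingularMetric

variable [MeasurableSpace X] {μ : Measure X} (h : SingularMetric n F μ)

/-- The curvature inequality `√-1 Θ_h(F) = √-1 Θ_g(F) + √-1 ∂∂̄ φ ≥ γ` in the sense of currents.
In terms of a local holomorphic frame `s` of `F`, the left-hand side is `√-1 ∂∂̄` of the locally
integrable function `φ - log |s|_g²`. It is tested, in holomorphic charts, against nonnegative
smooth functions with compact support and constant vectors. -/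
def CurvatureGE (γ : RealOneOneForm n X) : Prop :=
  ∀ c ∈ IsManifold.maximalAtlas 𝓘(ℂ, Cn n) ω X, ∀ (V : Set X) (s : ∀ x, F x),
    IsOpen V → IsHolomorphicFrame n s V → ∀ (ξ : Cn n) (χ : Cn n → ℝ),
      ContDiff ℝ ∞ χ → HasCompactSupport χ → tsupport χ ⊆ c.target ∩ c.symm ⁻¹' V →
      (∀ z, 0 ≤ χ z) →
      ∫ z, (γ.toFun (c.symm z) (chartVector c z ξ) (chartVector c z ξ)).re * χ z ≤
        ∫ z, ((h.φ (c.symm z)).toReal - Real.log (h.g.nrm (c.symm z) (s (c.symm z)) ^ 2)) *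
          complexHessian χ z ξ

/-- `|v|_h = |v|_g e^{-φ(x)}` for `v` in the fibre of `F` at `x`, with values in `[0, ∞]`. -/
def nrm (x : X) (v : F x) : ℝ≥0∞ :=
  ENNReal.ofReal (h.g.nrm x v) * EReal.exp (-h.φ x)

/-- `f` is a section over `V` of the multiplier ideal sheaf `𝓘(h)`: it is holomorphic on `V` and
`|f| e^{-φ}` is locally square integrable on `V`. -/
def MemMultiplierIdeal (V : Set X) (f : X → ℂ) : Prop :=
  HolomorphicOn n f V ∧ ∀ K : Set X, IsCompact K → K ⊆ V →
    ∫⁻ x in K, (‖f x‖ₑ * EReal.exp (-h.φ x)) ^ 2 ∂μ < ⊤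

/-- The functions `G₁, …, G_N` on the open set `B` generate the stalk of `𝓘(h)` at every point
of `B`: they are sections of `𝓘(h)` over `B`, and every germ of a section of `𝓘(h)` at a point of
`B` is a combination of their germs with coefficients germs of holomorphic functions. -/
def GeneratesStalks (B : Set X) {N : ℕ} (G : Fin N → X → ℂ) : Prop :=
  (∀ j, h.MemMultiplierIdeal B (G j)) ∧
  ∀ p ∈ B, ∀ (V : Set X) (f : X → ℂ), IsOpen V → p ∈ V → h.MemMultiplierIdeal V f →
    ∃ W : Set X, IsOpen W ∧ p ∈ W ∧ W ⊆ V ∩ B ∧ ∃ a : Fin N → X → ℂ,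
      (∀ j, HolomorphicOn n (a j) W) ∧ ∀ x ∈ W, f x = ∑ j, a j x * G j x

variable {h}

theorem MemMultiplierIdeal.zero (V : Set X) : h.MemMultiplierIdeal V (fun _ => 0) := by
  refine ⟨mdifferentiableOn_const, fun K _ _ => ?_⟩
  simp

theorem MemMultiplierIdeal.smul {V : Set X} {f : X → ℂ} (a : ℂ)
    (hf : h.MemMultiplierIdeal V f) : h.MemMultiplierIdeal V (fun x => a * f x) := by
  refine ⟨?_, fun K hK hKV => ?_⟩
  · exact MDifferentiableOn.const_smul a hf.1
  · have : ∀ x, (‖a * f x‖ₑ * EReal.exp (-h.φ x)) ^ 2 =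
        ‖a‖ₑ ^ 2 * (‖f x‖ₑ * EReal.exp (-h.φ x)) ^ 2 := by
      intro x
      rw [enorm_mul]; ring
    simp_rw [this]
    rw [lintegral_const_mul' _ _ (by simp)]
    exact ENNReal.mul_lt_top (by simp) (hf.2 K hK hKV)

theorem aemeasurable_exp : AEMeasurable (fun x => EReal.exp (-h.φ x)) μ := by
  have h1 : AEMeasurable (fun x => ENNReal.ofReal (Real.exp (-(h.φ x).toReal))) μ :=
    (Real.measurable_exp.comp_aemeasurable h.integrable.aemeasurable.neg).ennreal_ofReal
  refine h1.congr ?_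
  filter_upwards [h.ae_finite] with x hx
  rw [← EReal.exp_coe, EReal.coe_neg, EReal.coe_toReal hx.1 hx.2]

theorem MemMultiplierIdeal.add [BorelSpace X] [T2Space X] {V : Set X} {f g : X → ℂ}
    (hf : h.MemMultiplierIdeal V f) (hg : h.MemMultiplierIdeal V g) :
    h.MemMultiplierIdeal V (fun x => f x + g x) := by
  refine ⟨MDifferentiableOn.add hf.1 hg.1, fun K hK hKV => ?_⟩
  have hfm : AEMeasurable (fun x => (‖f x‖ₑ * EReal.exp (-h.φ x)) ^ 2) (μ.restrict K) := by
    have h1 : AEMeasurable f (μ.restrict K) :=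
      (hf.1.continuousOn.mono hKV).aemeasurable hK.measurableSet
    exact (h1.enorm.mul aemeasurable_exp.restrict).pow_const 2
  calc ∫⁻ x in K, (‖f x + g x‖ₑ * EReal.exp (-h.φ x)) ^ 2 ∂μ
      ≤ ∫⁻ x in K, 2 * ((‖f x‖ₑ * EReal.exp (-h.φ x)) ^ 2
          + (‖g x‖ₑ * EReal.exp (-h.φ x)) ^ 2) ∂μ := by
        refine lintegral_mono fun x => ?_
        calc (‖f x + g x‖ₑ * EReal.exp (-h.φ x)) ^ 2
            ≤ (‖f x‖ₑ * EReal.exp (-h.φ x) + ‖g x‖ₑ * EReal.exp (-h.φ x)) ^ 2 := by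
              rw [← add_mul]
              gcongr
              exact enorm_add_le _ _
          _ ≤ _ := by
              have := ENNReal.rpow_add_le_mul_rpow_add_rpow (‖f x‖ₑ * EReal.exp (-h.φ x))
                (‖g x‖ₑ * EReal.exp (-h.φ x)) (p := 2) (by norm_num)
              norm_num at this
              exact this
    _ = 2 * (∫⁻ x in K, (‖f x‖ₑ * EReal.exp (-h.φ x)) ^ 2 ∂μ
          + ∫⁻ x in K, (‖g x‖ₑ * EReal.exp (-h.φ x)) ^ 2 ∂μ) := by
        rw [lintegral_const_mul' _ _ (by simp), lintegral_add_left' hfm]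
    _ < ⊤ := ENNReal.mul_lt_top (by simp) (ENNReal.add_lt_top.2 ⟨hf.2 K hK hKV, hg.2 K hK hKV⟩)

variable (h) [VectorBundle ℂ ℂ F]

/-- The space of sections over the open set `U` of `F ⊗ 𝓘(h)`, that is, of the holomorphic
sections of `F` whose coordinate in each local trivialization of `F` is a section of `𝓘(h)`.
A section over `U` is encoded by its extension by zero outside `U`. -/
def sections [BorelSpace X] [T2Space X] (U : Set X) : Submodule ℂ (∀ x, F x) where
  carrier := {s | (∀ x, x ∉ U → s x = 0) ∧
    ∀ (e : Bundle.Trivialization ℂ (Bundle.TotalSpace.proj : Bundle.TotalSpace ℂ F → X))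
      [MemTrivializationAtlas e],
      h.MemMultiplierIdeal (U ∩ e.baseSet) (fun x => e.linearMapAt ℂ x (s x))}
  zero_mem' := by
    refine ⟨fun _ _ => rfl, fun e _ => ?_⟩
    simpa using MemMultiplierIdeal.zero _
  add_mem' := by
    intro s t hs ht
    refine ⟨fun x hx => by simp [hs.1 x hx, ht.1 x hx], fun e _ => ?_⟩
    simpa using (hs.2 e).add (ht.2 e)
  smul_mem' := by
    intro a s hs
    refine ⟨fun x hx => by simp [hs.1 x hx], fun e _ => ?_⟩
    simpa using (hs.2 e).smul a

/-- The space `C^p(𝓤, F ⊗ 𝓘(h))` of Čech `p`-cochains: families of sections of `F ⊗ 𝓘(h)` over the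
intersections `B_{i₀…i_p}`, indexed by all `(i₀, …, i_p)`. -/
def Cochain [BorelSpace X] [T2Space X] {ι : Type*} (B : ι → Set X) (p : ℕ) : Type _ :=
  ∀ i : Fin (p + 1) → ι, h.sections (⋂ k, B (i k))

instance [BorelSpace X] [T2Space X] {ι : Type*} (B : ι → Set X) (p : ℕ) :
    AddCommGroup (h.Cochain B p) :=
  inferInstanceAs (AddCommGroup (∀ i : Fin (p + 1) → ι, h.sections (⋂ k, B (i k))))

instance [BorelSpace X] [T2Space X] {ι : Type*} (B : ι → Set X) (p : ℕ) :
    Module ℂ (h.Cochain B p) :=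
  inferInstanceAs (Module ℂ (∀ i : Fin (p + 1) → ι, h.sections (⋂ k, B (i k))))

/-- The value at `x` of the component `f_{i₀…i_p}` of a cochain `f`. -/
def Cochain.val [BorelSpace X] [T2Space X] {h : SingularMetric n F μ} {ι : Type*} {B : ι → Set X}
    {p : ℕ} (f : h.Cochain B p) (i : Fin (p + 1) → ι) (x : X) : F x :=
  (f i : ∀ x, F x) x

end SingularMetric

end LineBundle

/-- The measurable relatively compact subsets `K ⋐ B_{i₀…i_p}`, for all `(i₀, …, i_p)`. -/
structure RelCompactIn {X : Type*} [TopologicalSpace X] [MeasurableSpace X] {ι : Type*}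
    (B : ι → Set X) (p : ℕ) where
  idx : Fin (p + 1) → ι
  K : Set X
  measurableSet : MeasurableSet K
  isCompact_closure : IsCompact (closure K)
  closure_subset : closure K ⊆ ⋂ k, B (idx k)

/-- A complex Fréchet space: a Hausdorff locally convex topological vector space that is
metrizable and complete. -/
structure IsFrechetSpace (E : Type*) [AddCommGroup E] [Module ℂ E] [TopologicalSpace E] :
    Prop where
  isTopologicalAddGroup : IsTopologicalAddGroup E
  continuousSMul : ContinuousSMul ℂ E
  locallyConvexSpace : LocallyConvexSpace ℝ E
  t2Space : T2Space E
  metrizableSpace : TopologicalSpace.MetrizableSpace E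
  completeSpace : @CompleteSpace E (IsTopologicalAddGroup.rightUniformSpace E)

end CechFrechet

end

noncomputable section

namespace CechFrechet

/-! ### Jensen's formula, subharmonicity of log |f|, and a weighted mean value inequality. -/

section LogSubharmonic

open Metric Real

/-! The one point that is not formal: L²-convergence with weight e^{-2φ} on compact sets forces
locally uniform convergence of coordinates, although φ is only assumed integrable. Let ψ = φ⁺ and
let f be holomorphic near a closed ball with centre c. Since log |f| is subharmonic, its value at c
is at most its mean. Jensen's inequality for exp then gives |f(c)|² exp(-2 · mean of ψ) ≤ mean of
|f|² e^{-2ψ} (`norm_sq_mul_exp_le_setIntegral`), and e^{-2ψ} ≤ e^{-2φ}. Means of ψ over balls of a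
fixed radius are bounded through the L¹-norm, so point values are controlled, locally uniformly, by
L²-norms (`exists_enorm_sq_coord_le`).

The rest follows from this bound. A section whose seminorms all vanish is zero. An L²-Cauchy
sequence of sections has locally uniformly Cauchy coordinates, so its limit is holomorphic; Fatou's
lemma shows that the convergence also holds in L² on compact sets, which keeps the limit in 𝓘(h)
(`exists_section_limit`). Finally, a compact manifold is second countable, so each of the finitely
many B_{i₀…i_p} is exhausted by countably many compact sets. Countably many seminorms therefore
define the topology: it is metrizable, and completeness can be tested on sequences. -/

theorem log_norm_le_circleAverage_log_max {g : ℂ → ℂ} (hg : AnalyticOnNhd ℂ g (closedBall 0 1))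
    (h0 : g 0 ≠ 0) {δ : ℝ} (hδ : 0 < δ) :
    log ‖g 0‖ ≤ circleAverage (fun z => log (max ‖g z‖ δ)) 0 1 := by
  -- Jensen's formula: the circle average exceeds log |g(0)| by a sum over the zeros u of g, whose
  -- terms are nonnegative because |u| ≤ 1.
  have hJ := AnalyticOnNhd.circleAverage_log_norm (c := 0) (R := 1) one_ne_zero
    (by simpa using hg) h0
  have hsum : 0 ≤ ∑ᶠ u, (MeromorphicOn.divisor g (closedBall 0 |1|) u : ℝ) *
      log (1 * ‖(0 : ℂ) - u‖⁻¹) := by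
    refine finsum_nonneg fun u => ?_
    by_cases hu : u ∈ closedBall (0 : ℂ) |1|
    · refine mul_nonneg ?_ ?_
      · have := MeromorphicOn.AnalyticOnNhd.divisor_nonneg (𝕜 := ℂ) (U := closedBall (0 : ℂ) |1|) (f := g)
          (by simpa using hg) u
        exact_mod_cast this
      · rcases eq_or_ne u 0 with rfl | hu0
        · simp
        · refine log_nonneg ?_
          have : ‖u‖ ≤ 1 := by simpa using hu
          rw [one_mul, zero_sub, norm_neg]
          exact (one_le_inv₀ (norm_pos_iff.2 hu0)).2 this
    · simp [Function.locallyFinsuppWithin.apply_eq_zero_of_notMem _ hu]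
  have hle : log ‖g 0‖ ≤ circleAverage (fun z => log ‖g z‖) 0 1 := by
    rw [hJ]; linarith
  refine hle.trans ?_
  have hcod : g ⁻¹' {0}ᶜ ∈ Filter.codiscreteWithin (sphere (0 : ℂ) |1|) := by
    refine Filter.codiscreteWithin_mono (U := closedBall (0 : ℂ) 1) (by
      simpa using sphere_subset_closedBall)
      (hg.preimage_zero_mem_codiscreteWithin (x := 0) h0 (by simp) ?_)
    exact ⟨⟨0, by simp⟩, (convex_closedBall _ _).isPreconnected⟩
  have hcont : ContinuousOn (fun z => log (max ‖g z‖ δ)) (sphere (0 : ℂ) |1|) := by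
    refine ContinuousOn.log ?_ fun z _ => (lt_max_of_lt_right hδ).ne'
    refine ContinuousOn.sup (ContinuousOn.norm ?_) continuousOn_const
    exact hg.continuousOn.mono (by simpa using sphere_subset_closedBall)
  have hI1 : CircleIntegrable (fun z => log ‖g z‖) 0 1 :=
    MeromorphicOn.circleIntegrable_log_norm fun z hz =>
      (hg z (sphere_subset_closedBall (by simpa using hz))).meromorphicAt
  have hI2 : CircleIntegrable (fun z => log (max ‖g z‖ δ)) 0 1 :=
    hcont.circleIntegrable'
  -- By convention `log 0 = 0`, which may exceed log δ. On the discrete zero set the value is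
  -- changed to log δ, so that the comparison holds everywhere and the average is unchanged.
  set k : ℂ → ℝ := fun z => if g z = 0 then log δ else log ‖g z‖ with hk
  have hkg : (fun z => log ‖g z‖) =ᶠ[Filter.codiscreteWithin (sphere (0 : ℂ) |1|)] k := by
    filter_upwards [hcod] with z hz
    have : g z ≠ 0 := hz
    simp [hk, this]
  rw [circleAverage_congr_codiscreteWithin hkg one_ne_zero]
  refine circleAverage_mono (hI1.congr_codiscreteWithin hkg) hI2 fun z _ => ?_
  by_cases hz : g z = 0
  · simp [hk, hz, max_eq_right hδ.le]
  · simp only [hk, hz, if_false]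
    exact log_le_log (norm_pos_iff.2 hz) (le_max_left _ _)

variable {n : ℕ}

/-- Multiplication by a complex number of modulus one, as a real linear isometry of `ℂⁿ`. -/
def unitSMul (a : Circle) : Cn n ≃ₗᵢ[ℝ] Cn n where
  toFun z := (a : ℂ) • z
  invFun z := ((a⁻¹ : Circle) : ℂ) • z
  map_add' := smul_add _
  map_smul' t z := smul_comm _ _ _
  left_inv z := by simp [smul_smul]
  right_inv z := by simp [smul_smul]
  norm_map' z := by
    change ‖(a : ℂ) • z‖ = ‖z‖
    rw [norm_smul, Circle.norm_coe, one_mul]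

theorem setIntegral_closedBall_smul (a : Circle) (u : Cn n → ℝ) (r : ℝ) :
    ∫ z in closedBall (0 : Cn n) r, u ((a : ℂ) • z) = ∫ z in closedBall (0 : Cn n) r, u z := by
  have h1 := (unitSMul (n := n) a).measurePreserving.setIntegral_preimage_emb
    (unitSMul (n := n) a).toHomeomorph.measurableEmbedding u (closedBall 0 r)
  rw [(unitSMul (n := n) a).preimage_closedBall] at h1
  simpa [unitSMul] using h1

/-- The one-variable inequality applies to ζ ↦ f(ζz) for every z in the ball. Integrating over z and
exchanging the integrals, rotation by e^{iθ} preserves the ball and its measure, so the integral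
over z does not depend on θ. The truncation at δ keeps the integrands continuous. -/
theorem log_norm_mul_volume_le_aux {f : Cn n → ℂ} {r : ℝ} {U : Set (Cn n)} (hU : IsOpen U)
    (hf : DifferentiableOn ℂ f U) (hrU : closedBall 0 r ⊆ U) (h0 : f 0 ≠ 0) {δ : ℝ} (hδ : 0 < δ) :
    log ‖f 0‖ * volume.real (closedBall (0 : Cn n) r) ≤
      ∫ z in closedBall (0 : Cn n) r, log (max ‖f z‖ δ) := by
  set S := closedBall (0 : Cn n) r with hS
  set u : Cn n → ℝ := fun z => log (max ‖f z‖ δ) with hu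
  have hucont : ContinuousOn u S := by
    refine ContinuousOn.log ?_ fun z _ => (lt_max_of_lt_right hδ).ne'
    exact ContinuousOn.sup (hf.continuousOn.mono hrU).norm continuousOn_const
  have hmem : ∀ (θ : ℝ) {z : Cn n}, z ∈ S → circleMap 0 1 θ • z ∈ S := by
    intro θ z hz
    simpa [hS, norm_smul] using hz
  have hslice : ∀ z ∈ S, 2 * π * log ‖f 0‖ ≤ ∫ θ in 0..2 * π, u (circleMap 0 1 θ • z) := by
    intro z hz
    have hlin : Differentiable ℂ fun ζ : ℂ => ζ • z := by fun_prop
    have hg : AnalyticOnNhd ℂ (fun ζ : ℂ => f (ζ • z)) ((fun ζ : ℂ => ζ • z) ⁻¹' U) :=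
      (hf.comp hlin.differentiableOn fun _ h => h).analyticOnNhd
        (hU.preimage hlin.continuous)
    have hsub : closedBall (0 : ℂ) 1 ⊆ (fun ζ : ℂ => ζ • z) ⁻¹' U := by
      intro ζ hζ
      apply hrU
      have h1 : ‖ζ‖ ≤ 1 := by simpa using hζ
      have h2 : ‖z‖ ≤ r := by simpa [hS] using hz
      have h3 : ‖ζ • z‖ ≤ r := by
        rw [norm_smul]
        nlinarith [norm_nonneg z, norm_nonneg ζ]
      exact mem_closedBall_zero_iff.2 h3
    have := log_norm_le_circleAverage_log_max (hg.mono hsub) (by simpa using h0) hδ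
    rw [circleAverage_def, smul_eq_mul, inv_mul_eq_div, le_div_iff₀ two_pi_pos] at this
    simpa [mul_comm] using this
  have hfin : volume S ≠ ⊤ := (isCompact_closedBall _ _).measure_ne_top
  have hint : IntegrableOn (fun q : Cn n × ℝ => u (circleMap 0 1 q.2 • q.1))
      (S ×ˢ Icc 0 (2 * π)) := by
    refine ContinuousOn.integrableOn_compact
      ((isCompact_closedBall _ _).prod isCompact_Icc) ?_
    refine hucont.comp (Continuous.continuousOn (by fun_prop)) ?_
    rintro ⟨z, θ⟩ ⟨hz, -⟩
    exact hmem θ hz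
  have hint' : Integrable (Function.uncurry fun (z : Cn n) (θ : ℝ) => u (circleMap 0 1 θ • z))
      ((volume.restrict S).prod (volume.restrict (Ioc 0 (2 * π)))) := by
    rw [Measure.prod_restrict]
    exact hint.mono_set (prod_mono_right Ioc_subset_Icc_self)
  have hswap := integral_integral_swap hint'
  have hrot : ∀ θ : ℝ, ∫ z in S, u (circleMap 0 1 θ • z) = ∫ z in S, u z := by
    intro θ
    have := setIntegral_closedBall_smul (Circle.exp θ) u r
    simpa [circleMap, Circle.coe_exp] using this
  simp_rw [hrot] at hswap
  rw [integral_const] at hswap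
  have hle : ∫ z in S, 2 * π * log ‖f 0‖ ≤
      ∫ z in S, ∫ θ in Ioc 0 (2 * π), u (circleMap 0 1 θ • z) := by
    refine setIntegral_mono_on (integrableOn_const hfin) hint'.integral_prod_left
      measurableSet_closedBall fun z hz => ?_
    rw [← intervalIntegral.integral_of_le two_pi_pos.le]
    exact hslice z hz
  rw [hswap, setIntegral_const] at hle
  simp only [measureReal_restrict_apply_univ, Real.volume_real_Ioc, sub_zero, smul_eq_mul,
    max_eq_left two_pi_pos.le] at hle
  have h2 := two_pi_pos
  nlinarith

theorem log_norm_mul_volume_le {f : Cn n → ℂ} {c : Cn n} {r : ℝ} {U : Set (Cn n)} (hU : IsOpen U)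
    (hf : DifferentiableOn ℂ f U) (hrU : closedBall c r ⊆ U) (h0 : f c ≠ 0) {δ : ℝ} (hδ : 0 < δ) :
    log ‖f c‖ * volume.real (closedBall c r) ≤
      ∫ z in closedBall c r, log (max ‖f z‖ δ) := by
  have hpre : (fun z => c + z) ⁻¹' closedBall c r = closedBall 0 r := by
    ext z; simp [dist_eq_norm]
  have hmp := measurePreserving_add_left (volume : Measure (Cn n)) c
  have hemb := (Homeomorph.addLeft c).measurableEmbedding
  have h1 := hmp.setIntegral_preimage_emb hemb (fun z => log (max ‖f z‖ δ)) (closedBall c r)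
  have h2 : volume.real (closedBall c r) = volume.real (closedBall (0 : Cn n) r) := by
    rw [← hpre, measureReal_def, measureReal_def,
      hmp.measure_preimage measurableSet_closedBall.nullMeasurableSet]
  rw [hpre] at h1
  rw [← h1, h2]
  have hd : Differentiable ℂ fun z : Cn n => c + z := by fun_prop
  have := log_norm_mul_volume_le_aux (f := fun z => f (c + z)) (r := r)
    (hU.preimage (hd.continuous)) (hf.comp hd.differentiableOn fun _ h => h)
    (by rw [← hpre]; exact preimage_mono hrU) (by simpa using h0) hδ
  simpa using this

/-- A weighted mean value inequality: by Jensen's inequality and the subharmonicity of `log |f|`,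
an `L¹`-bound on `ψ` suffices to control `|f(c)|²` by the integral of `|f|² e^{-2ψ}`. -/
theorem norm_sq_mul_exp_le_setIntegral {f : Cn n → ℂ} {c : Cn n} {r : ℝ} (hr : 0 < r)
    {U : Set (Cn n)} (hU : IsOpen U) (hf : DifferentiableOn ℂ f U) (hrU : closedBall c r ⊆ U)
    {ψ : Cn n → ℝ} (hψ0 : ∀ z, 0 ≤ ψ z) (hψ : IntegrableOn ψ (closedBall c r)) {M : ℝ}
    (hM : ∫ z in closedBall c r, ψ z ≤ M * volume.real (closedBall c r)) :
    volume.real (closedBall c r) * (‖f c‖ ^ 2 * exp (-2 * M)) ≤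
      ∫ z in closedBall c r, ‖f z‖ ^ 2 * exp (-2 * ψ z) := by
  set S := closedBall c r with hS
  set V := volume.real S with hVdef
  have hfin : volume S ≠ ⊤ := (isCompact_closedBall _ _).measure_ne_top
  have hV : 0 < V := ENNReal.toReal_pos (measure_closedBall_pos _ _ hr).ne' hfin
  have hSm : MeasurableSet S := measurableSet_closedBall
  by_cases h0 : f c = 0
  · simp only [h0, norm_zero, ne_eq, OfNat.ofNat_ne_zero, not_false_eq_true, zero_pow, zero_mul,
      mul_zero]
    positivity
  set a := ‖f c‖ with ha
  have ha0 : 0 < a := norm_pos_iff.2 h0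
  have hfc : ContinuousOn f S := hf.continuousOn.mono hrU
  have hexpm : AEStronglyMeasurable (fun z => exp (-2 * ψ z)) (volume.restrict S) :=
    Real.continuous_exp.comp_aestronglyMeasurable (hψ.aestronglyMeasurable.const_mul (-2))
  have hexp_le : ∀ z, ‖exp (-2 * ψ z)‖ ≤ 1 := fun z => by
    rw [Real.norm_of_nonneg (exp_pos _).le]
    exact exp_le_one_iff.2 (by linarith [hψ0 z])
  have hmul : ∀ v : Cn n → ℝ, ContinuousOn v S →
      IntegrableOn (fun z => v z * exp (-2 * ψ z)) S := fun v hv =>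
    (hv.integrableOn_compact (isCompact_closedBall _ _)).mul_bdd hexpm
      (Filter.Eventually.of_forall hexp_le)
  refine le_of_forall_pos_le_add fun ε hε => ?_
  -- Replacing |f|² by max(|f|, δ)² costs at most δ²V = ε, since e^{-2ψ} ≤ 1.
  obtain ⟨δ, hδ, hδε⟩ : ∃ δ : ℝ, 0 < δ ∧ δ ^ 2 * V = ε :=
    ⟨√(ε / V), by positivity, by rw [sq_sqrt (by positivity)]; field_simp⟩
  have hmax : ContinuousOn (fun z => max ‖f z‖ δ) S := hfc.norm.sup continuousOn_const
  have hu : IntegrableOn (fun z => log (max ‖f z‖ δ)) S :=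
    (hmax.log fun z _ => (lt_max_of_lt_right hδ).ne').integrableOn_compact
      (isCompact_closedBall _ _)
  have hlog := log_norm_mul_volume_le hU hf hrU h0 hδ
  set A := a ^ 2 * exp (-2 * M) with hA
  have hA0 : 0 < A := by positivity
  have hlogA : log A = 2 * log a - 2 * M := by
    rw [hA, log_mul (by positivity) (by positivity), log_exp, log_pow]; push_cast; ring
  -- Jensen's inequality via the tangent line of exp at log A: e^t ≥ A(1 + t - log A) with t = 2 log
  -- max(|f|, δ) - 2ψ. The mean of t is at least 2 log a - 2M = log A, so the left-hand side
  -- integrates to at least A · V.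
  have hpt : ∀ z ∈ S, A * (1 - log A + 2 * log (max ‖f z‖ δ) - 2 * ψ z) ≤
      ‖f z‖ ^ 2 * exp (-2 * ψ z) + δ ^ 2 := by
    intro z _
    have hm : 0 < max ‖f z‖ δ := lt_max_of_lt_right hδ
    have h1 := add_one_le_exp (2 * log (max ‖f z‖ δ) - 2 * ψ z - log A)
    have h2 : exp (2 * log (max ‖f z‖ δ) - 2 * ψ z - log A) =
        (max ‖f z‖ δ) ^ 2 * exp (-2 * ψ z) / A := by
      rw [exp_sub, exp_log hA0, sub_eq_add_neg, exp_add, ← neg_mul,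
        show (2 : ℝ) * log (max ‖f z‖ δ) = log ((max ‖f z‖ δ) ^ 2) by rw [log_pow]; norm_num,
        exp_log (by positivity)]
    rw [h2, le_div_iff₀ hA0] at h1
    have h3 : (max ‖f z‖ δ) ^ 2 ≤ ‖f z‖ ^ 2 + δ ^ 2 := by
      rcases max_choice ‖f z‖ δ with h | h <;> rw [h] <;> nlinarith [sq_nonneg δ, norm_nonneg (f z)]
    have h4 : exp (-2 * ψ z) ≤ 1 := exp_le_one_iff.2 (by linarith [hψ0 z])
    have h5 := exp_pos (-2 * ψ z)
    nlinarith [sq_nonneg δ]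
  have hint1 : IntegrableOn (fun z => 1 - log A + 2 * log (max ‖f z‖ δ) - 2 * ψ z) S :=
    ((integrableOn_const hfin).add (hu.const_mul 2)).sub (hψ.const_mul 2)
  have hint2 : IntegrableOn (fun z => ‖f z‖ ^ 2 * exp (-2 * ψ z)) S := hmul _ (hfc.norm.pow 2)
  have hmono := setIntegral_mono_on (hint1.const_mul A)
    (hint2.add (integrableOn_const (C := δ ^ 2) hfin)) hSm hpt
  rw [integral_const_mul] at hmono
  have e1 : ∫ z in S, (1 - log A + 2 * log (max ‖f z‖ δ) - 2 * ψ z) =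
      (1 - log A) * V + 2 * (∫ z in S, log (max ‖f z‖ δ)) - 2 * ∫ z in S, ψ z := by
    have hint0 : IntegrableOn (fun z => 1 - log A + 2 * log (max ‖f z‖ δ)) S :=
      (integrableOn_const hfin).add (hu.const_mul 2)
    rw [integral_sub hint0 (hψ.const_mul 2), integral_add (integrableOn_const (C := 1 - log A) hfin :)
      (hu.const_mul 2), integral_const_mul, integral_const_mul, setIntegral_const, smul_eq_mul, mul_comm V]
  have e2 : ∫ z in S, (‖f z‖ ^ 2 * exp (-2 * ψ z) + δ ^ 2) =
      (∫ z in S, ‖f z‖ ^ 2 * exp (-2 * ψ z)) + ε := by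
    rw [integral_add hint2 (integrableOn_const (C := δ ^ 2) hfin), setIntegral_const, smul_eq_mul,
      ← hδε, mul_comm V]
  rw [← e2]
  refine le_trans ?_ hmono
  rw [e1, mul_comm V A]
  refine mul_le_mul_of_nonneg_left ?_ hA0.le
  rw [hlogA]
  nlinarith

end LogSubharmonic

/-! ### Limits of holomorphic functions, and uniform constants on balls. -/

section EuclideanLimits

open Metric Filter Topology

variable {n : ℕ}

/-- A pointwise limit of holomorphic functions that is locally uniformly Cauchy is holomorphic. -/
theorem differentiableAt_of_uniformCauchySeqOn {f : ℕ → Cn n → ℂ} {g : Cn n → ℂ} {c : Cn n} {r : ℝ}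
    (hr : 0 < r) (hf : ∀ m, DifferentiableOn ℂ (f m) (ball c r))
    (hunif : UniformCauchySeqOn f atTop (ball c r))
    (hlim : ∀ z ∈ ball c r, Tendsto (fun m => f m z) atTop (𝓝 (g z))) :
    DifferentiableAt ℂ g c := by
  have hdiff : ∀ m, ∀ z ∈ ball c r, DifferentiableAt ℂ (f m) z := fun m z hz =>
    (hf m).differentiableAt (isOpen_ball.mem_nhds hz)
  have hsub : ∀ z ∈ ball c (r / 2), ball z (r / 2) ⊆ ball c r := fun z hz =>
    ball_subset_ball' (by have := mem_ball.1 hz; linarith)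
  have hcauchy : UniformCauchySeqOn (fun m => fderiv ℂ (f m)) atTop (ball c (r / 2)) := by
    rw [Metric.uniformCauchySeqOn_iff] at hunif ⊢
    intro ε hε
    -- On balls of radius r/2 the difference f_m - f_k varies by at most 2 · εr/8, so its derivative
    -- at the centre is at most ε/2.
    obtain ⟨N, hN⟩ := hunif (ε * r / 8) (by positivity)
    refine ⟨N, fun m hm k hk z hz => ?_⟩
    have hzr : z ∈ ball c r := ball_subset_ball (by linarith) hz
    have h1 : ‖fderiv ℂ (fun w => f m w - f k w) z‖ ≤ (ε * r / 8 + ε * r / 8) / (r / 2) := by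
      refine Complex.norm_fderiv_le_div_of_mapsTo_ball
        (((hf m).sub (hf k)).mono (hsub z hz)) (fun w hw => ?_) (by positivity)
      have h2 := hN m hm k hk w (hsub z hz hw)
      have h3 := hN m hm k hk z hzr
      rw [dist_eq_norm] at h2 h3
      rw [mem_closedBall, dist_eq_norm]
      exact (norm_sub_le _ _).trans (add_le_add h2.le h3.le)
    rw [dist_eq_norm, ← fderiv_fun_sub (hdiff m z hzr) (hdiff k z hzr)]
    refine h1.trans_lt ?_
    have : (ε * r / 8 + ε * r / 8) / (r / 2) = ε / 2 := by field_simp; norm_num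
    linarith
  choose! g' hg' using fun z (hz : z ∈ ball c (r / 2)) =>
    cauchySeq_tendsto_of_complete (hcauchy.cauchySeq hz)
  have htend := hcauchy.tendstoUniformlyOn_of_tendsto hg'
  have hsub' : ball c (r / 2) ⊆ ball c r := ball_subset_ball (by linarith)
  exact (hasFDerivAt_of_tendstoUniformlyOn isOpen_ball htend
    (fun m z hz => (hdiff m z (hsub' hz)).hasFDerivAt) (fun z hz => hlim z (hsub' hz))
    (mem_ball_self (by positivity))).differentiableAt

/-- The weighted mean value inequality, with a constant that is uniform on a ball. -/
theorem exists_enorm_sq_le_mul_lintegral {c : Cn n} {r : ℝ} (hr : 0 < r) {ψ : Cn n → ℝ}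
    (hψ0 : ∀ z, 0 ≤ ψ z) (hψ : IntegrableOn ψ (closedBall c (2 * r))) :
    ∃ C : ℝ≥0∞, C ≠ ⊤ ∧ ∀ (f : Cn n → ℂ) (U : Set (Cn n)), IsOpen U → DifferentiableOn ℂ f U →
      closedBall c (2 * r) ⊆ U → ∀ z ∈ closedBall c r,
      ‖f z‖ₑ ^ 2 ≤ C * ∫⁻ w in closedBall c (2 * r),
        ‖f w‖ₑ ^ 2 * ENNReal.ofReal (Real.exp (-2 * ψ w)) := by
  set V := volume.real (closedBall c r) with hV
  have hVpos : 0 < V := ENNReal.toReal_pos (measure_closedBall_pos _ _ hr).ne'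
    (isCompact_closedBall _ _).measure_ne_top
  set L := ∫ z in closedBall c (2 * r), ψ z with hL
  -- As ψ ≥ 0 and all balls of radius r have volume V, the mean of ψ over any such ball inside the
  -- double ball is at most L / V; hence one κ serves every centre z.
  set κ := V * Real.exp (-2 * (L / V)) with hκ
  have hκ0 : 0 < κ := by positivity
  refine ⟨ENNReal.ofReal κ⁻¹, ENNReal.ofReal_ne_top, fun f U hU hf hsub z hz => ?_⟩
  have hball : closedBall z r ⊆ closedBall c (2 * r) :=
    closedBall_subset_closedBall' (by have := mem_closedBall.1 hz; linarith)
  have hvol : volume.real (closedBall z r) = V := by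
    rw [hV, measureReal_def, measureReal_def, Measure.addHaar_closedBall_center,
      Measure.addHaar_closedBall_center volume c]
  have hψz := hψ.mono_set hball
  have hest := norm_sq_mul_exp_le_setIntegral hr hU hf (hball.trans hsub) hψ0 hψz (M := L / V) (by
    rw [hvol, div_mul_cancel₀ _ hVpos.ne']
    exact setIntegral_mono_set hψ (Eventually.of_forall hψ0) hball.eventuallyLE)
  rw [hvol] at hest
  have hle : ‖f z‖ ^ 2 ≤ κ⁻¹ * ∫ w in closedBall z r, ‖f w‖ ^ 2 * Real.exp (-2 * ψ w) := by
    rw [inv_mul_eq_div, le_div_iff₀ hκ0]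
    refine le_of_eq_of_le ?_ hest
    rw [hκ]; ring
  have hconv : ENNReal.ofReal (∫ w in closedBall z r, ‖f w‖ ^ 2 * Real.exp (-2 * ψ w)) ≤
      ∫⁻ w in closedBall z r, ‖f w‖ₑ ^ 2 * ENNReal.ofReal (Real.exp (-2 * ψ w)) := by
    refine (Real.ofReal_le_enorm _).trans ((enorm_integral_le_lintegral_enorm _).trans_eq ?_)
    refine lintegral_congr fun w => ?_
    rw [enorm_mul, enorm_pow, enorm_norm, Real.enorm_of_nonneg (Real.exp_pos _).le]
  calc ‖f z‖ₑ ^ 2 = ENNReal.ofReal (‖f z‖ ^ 2) := by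
        rw [ENNReal.ofReal_pow (norm_nonneg _), ofReal_norm]
    _ ≤ ENNReal.ofReal κ⁻¹ *
        ENNReal.ofReal (∫ w in closedBall z r, ‖f w‖ ^ 2 * Real.exp (-2 * ψ w)) := by
        rw [← ENNReal.ofReal_mul (by positivity)]
        exact ENNReal.ofReal_le_ofReal hle
    _ ≤ _ := by
        gcongr
        exact hconv.trans (lintegral_mono_set hball)

end EuclideanLimits

/-! ### Passing between the manifold and its charts. -/

section ChartTransfer

open Metric Filter Topology

variable {n : ℕ} {X : Type*} [TopologicalSpace X] [ChartedSpace (Cn n) X]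

theorem HolomorphicOn.differentiableOn_comp_symm [IsManifold 𝓘(ℂ, Cn n) ω X] {f : X → ℂ}
    {W : Set X} (hf : HolomorphicOn n f W) {c : OpenPartialHomeomorph X (Cn n)}
    (hc : c ∈ IsManifold.maximalAtlas 𝓘(ℂ, Cn n) ω X) :
    DifferentiableOn ℂ (f ∘ c.symm) (c.target ∩ c.symm ⁻¹' W) := by
  have h1 : MDifferentiableOn 𝓘(ℂ, Cn n) 𝓘(ℂ, Cn n) c.symm c.target :=
    (contMDiffOn_symm_of_mem_maximalAtlas hc).mdifferentiableOn (by simp)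
  have h2 : MDifferentiableOn 𝓘(ℂ, Cn n) 𝓘(ℂ, ℂ) (f ∘ c.symm) (c.target ∩ c.symm ⁻¹' W) :=
    MDifferentiableOn.comp hf (h1.mono inter_subset_left) inter_subset_right
  exact mdifferentiableOn_iff_differentiableOn.1 h2

theorem mdifferentiableAt_of_differentiableAt_comp_symm [IsManifold 𝓘(ℂ, Cn n) ω X] {f : X → ℂ}
    {c : OpenPartialHomeomorph X (Cn n)} (hc : c ∈ IsManifold.maximalAtlas 𝓘(ℂ, Cn n) ω X)
    {x : X} (hx : x ∈ c.source) (hf : DifferentiableAt ℂ (f ∘ c.symm) (c x)) :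
    MDifferentiableAt 𝓘(ℂ, Cn n) 𝓘(ℂ, ℂ) f x := by
  have h1 : MDifferentiableAt 𝓘(ℂ, Cn n) 𝓘(ℂ, Cn n) c x :=
    ((contMDiffOn_of_mem_maximalAtlas hc).contMDiffAt (c.open_source.mem_nhds hx)).mdifferentiableAt
      (by simp)
  have h2 := (hf.mdifferentiableAt).comp x h1
  refine h2.congr_of_eventuallyEq ?_
  filter_upwards [c.open_source.mem_nhds hx] with y hy
  simp [c.left_inv hy]

variable [MeasurableSpace X] [BorelSpace X] [T2Space X]

/-- On compact subsets of a chart, the measure of a smooth volume form dominates a multiple of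
Lebesgue measure. -/
theorem IsSmoothVolume.exists_lintegral_comp_symm_le {μ : Measure X} (hμ : IsSmoothVolume n μ)
    {c : OpenPartialHomeomorph X (Cn n)} (hc : c ∈ IsManifold.maximalAtlas 𝓘(ℂ, Cn n) ω X)
    {D : Set (Cn n)} (hD : IsCompact D) (hDc : D ⊆ c.target) :
    ∃ C : ℝ≥0∞, C ≠ ⊤ ∧ ∀ g : X → ℝ≥0∞, AEMeasurable g (μ.restrict (c.symm '' D)) →
      ∫⁻ z in D, g (c.symm z) ≤ C * ∫⁻ x in c.symm '' D, g x ∂μ ∧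
      AEMeasurable (fun z => g (c.symm z)) (volume.restrict D) := by
  obtain ⟨ρ, hρ, hρ0, hμρ⟩ := hμ c hc
  obtain ⟨m, hm, hmρ⟩ : ∃ m : ℝ, 0 < m ∧ ∀ z ∈ D, m ≤ ρ z := by
    rcases D.eq_empty_or_nonempty with rfl | hne
    · exact ⟨1, one_pos, by simp⟩
    · obtain ⟨z₀, hz₀, hmin⟩ := hD.exists_isMinOn hne (hρ.continuousOn.mono hDc)
      exact ⟨ρ z₀, hρ0 _ (hDc hz₀), fun z hz => hmin hz⟩
  have hcont : ContinuousOn c.symm D := c.continuousOn_symm.mono hDc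
  have hK : IsCompact (c.symm '' D) := hD.image_of_continuousOn hcont
  have hsymm : AEMeasurable c.symm (volume.restrict D) := hcont.aemeasurable hD.measurableSet
  -- Here m is a positive lower bound for the density on D. Comparing measures rather than integrals
  -- transfers a.e. measurability as well as the estimate; φ is only a.e. measurable.
  have hle : Measure.map c.symm (volume.restrict D) ≤
      ENNReal.ofReal m⁻¹ • μ.restrict (c.symm '' D) := by
    refine Measure.le_iff.2 fun A hA => ?_
    rw [Measure.map_apply_of_aemeasurable hsymm hA, Measure.smul_apply, smul_eq_mul,
      Measure.restrict_apply hA, hμρ _ (hA.inter hK.measurableSet) (by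
        rintro x ⟨-, z, hz, rfl⟩
        exact c.map_target (hDc hz))]
    have hset : c.target ∩ c.symm ⁻¹' (A ∩ c.symm '' D) = c.symm ⁻¹' A ∩ D := by
      ext z
      constructor
      · rintro ⟨hz, hzA, w, hw, hwz⟩
        rw [← c.symm.injOn (hDc hw) hz hwz]
        exact ⟨by simpa [hwz] using hzA, hw⟩
      · rintro ⟨hzA, hz⟩
        exact ⟨hDc hz, hzA, z, hz, rfl⟩
    rw [hset, Measure.restrict_apply₀ (hsymm.nullMeasurableSet_preimage hA)]
    have hnull : NullMeasurableSet (c.symm ⁻¹' A ∩ D) volume := by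
      have := hsymm.nullMeasurableSet_preimage hA
      exact (nullMeasurableSet_restrict hD.measurableSet.nullMeasurableSet).1 this
    calc volume (c.symm ⁻¹' A ∩ D)
        = ENNReal.ofReal m⁻¹ * ∫⁻ _ in c.symm ⁻¹' A ∩ D, ENNReal.ofReal m := by
          rw [setLIntegral_const, ← mul_assoc, ← ENNReal.ofReal_mul (by positivity),
            inv_mul_cancel₀ hm.ne', ENNReal.ofReal_one, one_mul]
      _ ≤ _ := by
          gcongr 1
          refine lintegral_mono_ae ((ae_restrict_iff'₀ hnull).2 (Eventually.of_forall fun z hz => ?_))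
          exact ENNReal.ofReal_le_ofReal (hmρ z hz.2)
  refine ⟨ENNReal.ofReal m⁻¹, ENNReal.ofReal_ne_top, fun g hg => ?_⟩
  have hg' : AEMeasurable g (Measure.map c.symm (volume.restrict D)) :=
    (hg.smul_measure _).mono_measure hle
  refine ⟨?_, hg'.comp_aemeasurable hsymm⟩
  rw [← lintegral_map' hg' hsymm, ← smul_eq_mul, ← lintegral_smul_measure]
  exact lintegral_mono' hle le_rfl

end ChartTransfer

/-! ### Local frames and smooth metrics on the line bundle. -/

section Frames

variable {n : ℕ} {X : Type*} [TopologicalSpace X] [ChartedSpace (Cn n) X]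
  {F : X → Type*} [TopologicalSpace (Bundle.TotalSpace ℂ F)] [∀ x, TopologicalSpace (F x)]
  [∀ x, AddCommGroup (F x)] [∀ x, Module ℂ (F x)] [FiberBundle ℂ F] [VectorBundle ℂ ℂ F]

/-- The frame defined by a local trivialization. -/
def trivFrame (e : Bundle.Trivialization ℂ (Bundle.TotalSpace.proj : Bundle.TotalSpace ℂ F → X))
    (x : X) : F x := e.symm x 1

theorem isHolomorphicFrame_trivFrame [IsManifold 𝓘(ℂ, Cn n) ω X]
    [ContMDiffVectorBundle ω ℂ F 𝓘(ℂ, Cn n)]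
    (e : Bundle.Trivialization ℂ (Bundle.TotalSpace.proj : Bundle.TotalSpace ℂ F → X))
    [MemTrivializationAtlas e] : IsHolomorphicFrame n (trivFrame e) e.baseSet := by
  constructor
  · have h1 : ContMDiffOn 𝓘(ℂ, Cn n) (𝓘(ℂ, Cn n).prod 𝓘(ℂ, ℂ)) ω
        (fun x => Bundle.TotalSpace.mk' ℂ x (trivFrame e x)) e.baseSet := by
      intro x hx
      rw [e.contMDiffWithinAt_section _ hx]
      refine (contMDiffWithinAt_const (c := (1 : ℂ))).congr (fun y hy => ?_) ?_
      · simp [trivFrame, e.apply_mk_symm hy]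
      · simp [trivFrame, e.apply_mk_symm hx]
    exact h1.mdifferentiableOn (by simp)
  · intro x hx h0
    have h1 := e.linearMapAt_symmₗ (R := ℂ) hx 1
    rw [e.coe_symmₗ hx, show e.symm x 1 = 0 from h0] at h1
    simp at h1

theorem eq_linearMapAt_smul_trivFrame
    (e : Bundle.Trivialization ℂ (Bundle.TotalSpace.proj : Bundle.TotalSpace ℂ F → X))
    [MemTrivializationAtlas e] {x : X} (hx : x ∈ e.baseSet) (v : F x) :
    v = e.linearMapAt ℂ x v • trivFrame e x := by
  have h1 := e.symmₗ_linearMapAt (R := ℂ) hx v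
  conv_lhs => rw [← h1]
  rw [trivFrame, ← e.coe_symmₗ (R := ℂ) hx, ← map_smul, smul_eq_mul, mul_one]

open Filter Topology in
/-- The pointwise limit of a sequence of sections whose coordinates are Cauchy sequences. -/
theorem exists_tendsto_coord {U : Set X} {s : ℕ → ∀ x, F x}
    (hconv : ∀ (e : Bundle.Trivialization ℂ (Bundle.TotalSpace.proj : Bundle.TotalSpace ℂ F → X))
      [MemTrivializationAtlas e], ∀ x ∈ U ∩ e.baseSet,
        CauchySeq fun m => e.linearMapAt ℂ x (s m x)) (x : X) :
    ∃ v : F x, (x ∉ U → v = 0) ∧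
      ∀ (e : Bundle.Trivialization ℂ (Bundle.TotalSpace.proj : Bundle.TotalSpace ℂ F → X))
        [MemTrivializationAtlas e], x ∈ U ∩ e.baseSet →
        Tendsto (fun m => e.linearMapAt ℂ x (s m x)) atTop (𝓝 (e.linearMapAt ℂ x v)) := by
  by_cases hx : x ∈ U
  · have hxe := FiberBundle.mem_baseSet_trivializationAt' (F := ℂ) (E := F) x
    obtain ⟨L, hL⟩ := cauchySeq_tendsto_of_complete (hconv (trivializationAt ℂ F x) x ⟨hx, hxe⟩)
    refine ⟨L • trivFrame (trivializationAt ℂ F x) x, fun hxU => absurd hx hxU, fun e _ hxe' => ?_⟩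
    -- At a fixed x, two trivializations differ by a scalar independent of m, so convergence in one
    -- gives convergence in all.
    have h1 : ∀ m, e.linearMapAt ℂ x (s m x) =
        (trivializationAt ℂ F x).linearMapAt ℂ x (s m x) *
          e.linearMapAt ℂ x (trivFrame (trivializationAt ℂ F x) x) := fun m => by
      conv_lhs => rw [eq_linearMapAt_smul_trivFrame (trivializationAt ℂ F x) hxe (s m x)]
      rw [map_smul, smul_eq_mul]
    simp_rw [h1, map_smul, smul_eq_mul]
    exact hL.mul_const _
  · exact ⟨0, fun _ => rfl, fun e _ hxe => absurd hxe.1 hx⟩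

namespace HermitianMetric

variable (g : HermitianMetric n F)

theorem nrm_eq_mul
    (e : Bundle.Trivialization ℂ (Bundle.TotalSpace.proj : Bundle.TotalSpace ℂ F → X))
    [MemTrivializationAtlas e] {x : X} (hx : x ∈ e.baseSet) (v : F x) :
    g.nrm x v = ‖e.linearMapAt ℂ x v‖ * g.nrm x (trivFrame e x) := by
  conv_lhs => rw [eq_linearMapAt_smul_trivFrame e hx v]
  rw [g.nrm_smul]

theorem continuousOn_nrm_trivFrame [IsManifold 𝓘(ℂ, Cn n) ω X]
    [ContMDiffVectorBundle ω ℂ F 𝓘(ℂ, Cn n)]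
    (e : Bundle.Trivialization ℂ (Bundle.TotalSpace.proj : Bundle.TotalSpace ℂ F → X))
    [MemTrivializationAtlas e] : ContinuousOn (fun x => g.nrm x (trivFrame e x)) e.baseSet :=
  (g.smooth _ _ e.open_baseSet (isHolomorphicFrame_trivFrame e)).continuousOn

theorem nrm_trivFrame_pos [IsManifold 𝓘(ℂ, Cn n) ω X] [ContMDiffVectorBundle ω ℂ F 𝓘(ℂ, Cn n)]
    (e : Bundle.Trivialization ℂ (Bundle.TotalSpace.proj : Bundle.TotalSpace ℂ F → X))
    [MemTrivializationAtlas e] {x : X} (hx : x ∈ e.baseSet) : 0 < g.nrm x (trivFrame e x) :=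
  g.nrm_pos _ _ ((isHolomorphicFrame_trivFrame (n := n) e).2 x hx)

omit [VectorBundle ℂ ℂ F] in
theorem nrm_nonneg (x : X) (v : F x) : 0 ≤ g.nrm x v := by
  by_cases hv : v = 0
  · have := g.nrm_smul x 0 v
    simp [hv] at this
    simp [hv, this]
  · exact (g.nrm_pos x v hv).le

/-- The fibre is a line, so homogeneity makes the norm a constant multiple of the absolute value of
a coordinate, and the triangle inequality comes for free. -/
theorem nrm_add_le (x : X) (v w : F x) : g.nrm x (v + w) ≤ g.nrm x v + g.nrm x w := by
  have hx := FiberBundle.mem_baseSet_trivializationAt' (F := ℂ) (E := F) x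
  rw [g.nrm_eq_mul (trivializationAt ℂ F x) hx, g.nrm_eq_mul (trivializationAt ℂ F x) hx v,
    g.nrm_eq_mul (trivializationAt ℂ F x) hx w, map_add, ← add_mul]
  exact mul_le_mul_of_nonneg_right (norm_add_le _ _) (g.nrm_nonneg _ _)

end HermitianMetric

end Frames

/-! ### The singular metric in local coordinates, and the local sup bound by L²-norms. -/

namespace SingularMetric

open Metric Filter Topology

variable {n : ℕ} {X : Type*} [TopologicalSpace X] [ChartedSpace (Cn n) X]
  {F : X → Type*} [TopologicalSpace (Bundle.TotalSpace ℂ F)] [∀ x, TopologicalSpace (F x)]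
  [∀ x, AddCommGroup (F x)] [∀ x, Module ℂ (F x)] [FiberBundle ℂ F] [VectorBundle ℂ ℂ F]
  [MeasurableSpace X] {μ : Measure X} (h : SingularMetric n F μ)

theorem nrm_add_le (x : X) (v w : F x) : h.nrm x (v + w) ≤ h.nrm x v + h.nrm x w := by
  rw [nrm, nrm, nrm, ← add_mul, ← ENNReal.ofReal_add (h.g.nrm_nonneg _ _) (h.g.nrm_nonneg _ _)]
  gcongr
  exact h.g.nrm_add_le x v w

omit [VectorBundle ℂ ℂ F] in
theorem nrm_smul (x : X) (a : ℂ) (v : F x) : h.nrm x (a • v) = ‖a‖ₑ * h.nrm x v := by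
  rw [nrm, nrm, h.g.nrm_smul, ENNReal.ofReal_mul (norm_nonneg _), ofReal_norm, mul_assoc]

theorem nrm_eq_mul
    (e : Bundle.Trivialization ℂ (Bundle.TotalSpace.proj : Bundle.TotalSpace ℂ F → X))
    [MemTrivializationAtlas e] {x : X} (hx : x ∈ e.baseSet) (v : F x) :
    h.nrm x v = ENNReal.ofReal (h.g.nrm x (trivFrame e x)) *
      (‖e.linearMapAt ℂ x v‖ₑ * EReal.exp (-h.φ x)) := by
  rw [nrm, h.g.nrm_eq_mul e hx, ENNReal.ofReal_mul (norm_nonneg _), ofReal_norm]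
  ring

variable [IsManifold 𝓘(ℂ, Cn n) ω X] [ContMDiffVectorBundle ω ℂ F 𝓘(ℂ, Cn n)]

/-- The ratio of the two sides is the g-norm of the frame, continuous and positive, hence bounded
above and below on a compact set; the possibly infinite factor e^{-φ} is common to both. -/
theorem exists_nrm_comparable
    (e : Bundle.Trivialization ℂ (Bundle.TotalSpace.proj : Bundle.TotalSpace ℂ F → X))
    [MemTrivializationAtlas e] {K : Set X} (hK : IsCompact K) (hKe : K ⊆ e.baseSet) :
    ∃ C : ℝ≥0∞, C ≠ ⊤ ∧ ∀ x ∈ K, ∀ v : F x,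
      ‖e.linearMapAt ℂ x v‖ₑ * EReal.exp (-h.φ x) ≤ C * h.nrm x v ∧
      h.nrm x v ≤ C * (‖e.linearMapAt ℂ x v‖ₑ * EReal.exp (-h.φ x)) := by
  have hcont := (h.g.continuousOn_nrm_trivFrame e).mono hKe
  have hinv : ContinuousOn (fun x => (h.g.nrm x (trivFrame e x))⁻¹) K :=
    hcont.inv₀ fun x hx => (h.g.nrm_trivFrame_pos e (hKe hx)).ne'
  obtain ⟨C₁, hC₁⟩ := hK.exists_bound_of_continuousOn hcont
  obtain ⟨C₂, hC₂⟩ := hK.exists_bound_of_continuousOn hinv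
  refine ⟨ENNReal.ofReal (max C₁ C₂), ENNReal.ofReal_ne_top, fun x hx v => ?_⟩
  have hpos := h.g.nrm_trivFrame_pos e (hKe hx)
  rw [h.nrm_eq_mul e (hKe hx)]
  constructor
  · rw [← mul_assoc, ← ENNReal.ofReal_mul' hpos.le]
    refine le_mul_of_one_le_left zero_le ?_
    rw [ENNReal.one_le_ofReal]
    have h1 := (le_abs_self _).trans ((hC₂ x hx).trans (le_max_right C₁ C₂))
    rwa [inv_le_iff_one_le_mul₀ hpos] at h1
  · gcongr
    exact (le_abs_self _).trans ((hC₁ x hx).trans (le_max_left C₁ C₂))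

variable [BorelSpace X] [T2Space X]

variable {h} in
theorem continuousOn_nrm {U : Set X} (hU : IsOpen U) {s : ∀ x, F x} (hs : s ∈ h.sections U) :
    ContinuousOn (fun x => h.g.nrm x (s x)) U := by
  intro x hx
  have hxe := FiberBundle.mem_baseSet_trivializationAt' (F := ℂ) (E := F) x
  set e := trivializationAt ℂ F x
  have hnhds : U ∩ e.baseSet ∈ 𝓝 x := (hU.inter e.open_baseSet).mem_nhds ⟨hx, hxe⟩
  have h1 : ContinuousOn (fun y => ‖e.linearMapAt ℂ y (s y)‖ * h.g.nrm y (trivFrame e y))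
      (U ∩ e.baseSet) :=
    ((hs.2 e).1.continuousOn.norm).mul
      ((h.g.continuousOn_nrm_trivFrame e).mono inter_subset_right)
  refine ((h1.continuousAt hnhds).congr ?_).continuousWithinAt
  filter_upwards [hnhds] with y hy
  exact (h.g.nrm_eq_mul e hy.2 _).symm

variable {h} in
theorem aemeasurable_nrm {U : Set X} (hU : IsOpen U) {s : ∀ x, F x} (hs : s ∈ h.sections U) :
    AEMeasurable (fun x => h.nrm x (s x)) (μ.restrict U) :=
  ((continuousOn_nrm hU hs).aemeasurable hU.measurableSet).ennreal_ofReal.mul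
    aemeasurable_exp.restrict

variable {h} in
-- Membership in 𝓘(h) only gives finiteness on compact sets inside one trivialization; finitely many
-- of these cover the closure of K.
theorem lintegral_nrm_sq_lt_top [LocallyCompactSpace X] {U : Set X} (hU : IsOpen U) {s : ∀ x, F x}
    (hs : s ∈ h.sections U) {K : Set X} (hK : IsCompact (closure K)) (hKU : closure K ⊆ U) :
    ∫⁻ x in K, h.nrm x (s x) ^ 2 ∂μ < ⊤ := by
  refine lt_of_le_of_lt (lintegral_mono_set subset_closure) ?_
  refine hK.induction_on (p := fun S => ∫⁻ x in S, h.nrm x (s x) ^ 2 ∂μ < ⊤) (by simp)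
    (fun S T hST hT => (lintegral_mono_set hST).trans_lt hT)
    (fun S T hS hT => (lintegral_union_le _ S T).trans_lt (ENNReal.add_lt_top.2 ⟨hS, hT⟩))
    fun x hx => ?_
  have hxe := FiberBundle.mem_baseSet_trivializationAt' (F := ℂ) (E := F) x
  set e := trivializationAt ℂ F x
  obtain ⟨T, hT, hTU, hTc⟩ := local_compact_nhds
    ((hU.inter e.open_baseSet).mem_nhds ⟨hKU hx, hxe⟩)
  refine ⟨T, mem_nhdsWithin_of_mem_nhds hT, ?_⟩
  obtain ⟨C, hC, hle⟩ := h.exists_nrm_comparable e hTc (hTU.trans inter_subset_right)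
  calc ∫⁻ x in T, h.nrm x (s x) ^ 2 ∂μ
      ≤ ∫⁻ x in T, C ^ 2 * (‖e.linearMapAt ℂ x (s x)‖ₑ * EReal.exp (-h.φ x)) ^ 2 ∂μ := by
        refine setLIntegral_mono' hTc.measurableSet fun y hy => ?_
        rw [← mul_pow]
        gcongr
        exact (hle y hy _).2
    _ = C ^ 2 * ∫⁻ x in T, (‖e.linearMapAt ℂ x (s x)‖ₑ * EReal.exp (-h.φ x)) ^ 2 ∂μ :=
        lintegral_const_mul' _ _ (by finiteness)
    _ < ⊤ := ENNReal.mul_lt_top (by finiteness) ((hs.2 e).2 T hTc hTU)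

/-- Near each point, the coordinate of a section of `F ⊗ 𝓘(h)` is bounded by its `L²`-norm with
respect to `h` on a fixed compact set. The weight `φ` only has to be integrable for this: no lower
bound on its complex Hessian is used. -/
theorem exists_enorm_sq_coord_le (hμ : IsSmoothVolume n μ) {U : Set X} (hU : IsOpen U)
    (e : Bundle.Trivialization ℂ (Bundle.TotalSpace.proj : Bundle.TotalSpace ℂ F → X))
    [MemTrivializationAtlas e] {x₀ : X} (hx₀ : x₀ ∈ U) (hx₀e : x₀ ∈ e.baseSet) :
    ∃ W ∈ 𝓝 x₀, W ⊆ U ∩ e.baseSet ∧ ∃ K : Set X, IsCompact K ∧ K ⊆ U ∧ ∃ C : ℝ≥0∞, C ≠ ⊤ ∧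
      ∀ s ∈ h.sections U, ∀ x ∈ W,
        ‖e.linearMapAt ℂ x (s x)‖ₑ ^ 2 ≤ C * ∫⁻ y in K, h.nrm y (s y) ^ 2 ∂μ := by
  set c := chartAt (Cn n) x₀ with hc
  have hcm : c ∈ IsManifold.maximalAtlas 𝓘(ℂ, Cn n) ω X := IsManifold.chart_mem_maximalAtlas x₀
  have hx₀c : x₀ ∈ c.source := mem_chart_source _ x₀
  set O := c.target ∩ c.symm ⁻¹' (U ∩ e.baseSet) with hO
  have hOo : IsOpen O := c.isOpen_inter_preimage_symm (hU.inter e.open_baseSet)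
  have hcx₀ : c x₀ ∈ O := ⟨c.map_source hx₀c, by simp [c.left_inv hx₀c, hx₀, hx₀e]⟩
  obtain ⟨R, hR, hRO⟩ := Metric.nhds_basis_closedBall.mem_iff.1 (hOo.mem_nhds hcx₀)
  obtain ⟨r, hr, rfl⟩ : ∃ r, 0 < r ∧ R = 2 * r := ⟨R / 2, by positivity, by ring⟩
  set D := closedBall (c x₀) (2 * r) with hD
  have hDc : IsCompact D := isCompact_closedBall _ _
  set K := c.symm '' D with hK
  have hKc : IsCompact K :=
    hDc.image_of_continuousOn (c.continuousOn_symm.mono (hRO.trans inter_subset_left))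
  have hKU : K ⊆ U ∩ e.baseSet := by
    rintro _ ⟨z, hz, rfl⟩
    exact (hRO hz).2
  obtain ⟨C₀, hC₀, hcmp⟩ := h.exists_nrm_comparable e hKc (hKU.trans inter_subset_right)
  obtain ⟨C₁, hC₁, htrans⟩ := hμ.exists_lintegral_comp_symm_le hcm hDc (hRO.trans inter_subset_left)
  -- The positive part remains integrable, is nonnegative as the mean value inequality requires, and
  -- satisfies e^{-2ψ} ≤ e^{-2φ}.
  set ψ : X → ℝ := fun x => max (h.φ x).toReal 0 with hψ
  have hψi : Integrable ψ μ := h.integrable.pos_part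
  have hψD : IntegrableOn (fun z => ψ (c.symm z)) D := by
    have h1 := htrans (fun x => ENNReal.ofReal (ψ x)) hψi.aemeasurable.restrict.ennreal_ofReal
    have h2 : ∫⁻ x in K, ENNReal.ofReal (ψ x) ∂μ < ⊤ :=
      ((lintegral_mono fun x => Real.ofReal_le_enorm _).trans (setLIntegral_le_lintegral _ _)).trans_lt
        hψi.2
    have h3 := integrable_toReal_of_lintegral_ne_top h1.2
      (h1.1.trans_lt (ENNReal.mul_lt_top hC₁.lt_top h2)).ne
    exact h3.congr (Eventually.of_forall fun z => ENNReal.toReal_ofReal (le_max_right _ _))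
  obtain ⟨C₂, hC₂, hmean⟩ := exists_enorm_sq_le_mul_lintegral hr
    (fun z => le_max_right (h.φ (c.symm z)).toReal 0) hψD
  -- W comes from the small ball, K from the double ball. The constants are C₂ from the mean value
  -- inequality, C₁ from Lebesgue measure against μ, and C₀² from coordinate against h-norm.
  refine ⟨c.source ∩ c ⁻¹' ball (c x₀) r, ?_, ?_, K, hKc, hKU.trans inter_subset_left,
    C₂ * (C₁ * C₀ ^ 2), by finiteness, ?_⟩
  · exact (c.isOpen_inter_preimage isOpen_ball).mem_nhds ⟨hx₀c, mem_ball_self hr⟩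
  · rintro x ⟨hx, hxr⟩
    refine hKU ⟨c x, ?_, c.left_inv hx⟩
    exact closedBall_subset_closedBall (by linarith) (ball_subset_closedBall hxr)
  rintro s hs x ⟨hx, hxr⟩
  have hhol := (hs.2 e).1
  have h1 := hmean _ O hOo (hhol.differentiableOn_comp_symm hcm) hRO (c x)
    (ball_subset_closedBall hxr)
  simp only [Function.comp_apply] at h1
  have hmeas : AEMeasurable (fun y => ‖e.linearMapAt ℂ y (s y)‖ₑ ^ 2 *
      ENNReal.ofReal (Real.exp (-2 * ψ y))) (μ.restrict K) := by
    have hm1 : AEMeasurable (fun y => e.linearMapAt ℂ y (s y)) (μ.restrict K) :=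
      (hhol.continuousOn.mono hKU).aemeasurable hKc.measurableSet
    exact (hm1.enorm.pow_const 2).mul (Real.measurable_exp.comp_aemeasurable
      (hψi.aemeasurable.restrict.const_mul (-2))).ennreal_ofReal
  refine (congrArg (fun y => ‖e.linearMapAt ℂ y (s y)‖ₑ ^ 2) (c.left_inv hx)).symm.le.trans
    (h1.trans ?_)
  rw [mul_assoc]
  gcongr
  refine (htrans _ hmeas).1.trans ?_
  rw [mul_assoc]
  gcongr
  rw [← lintegral_const_mul' _ _ (by finiteness)]
  refine lintegral_mono_ae ?_
  filter_upwards [ae_restrict_of_ae h.ae_finite, ae_restrict_mem hKc.measurableSet] with y hy hyK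
  calc ‖e.linearMapAt ℂ y (s y)‖ₑ ^ 2 * ENNReal.ofReal (Real.exp (-2 * ψ y))
      ≤ (‖e.linearMapAt ℂ y (s y)‖ₑ * EReal.exp (-h.φ y)) ^ 2 := by
        rw [mul_pow]
        gcongr
        rw [← EReal.coe_toReal hy.1 hy.2, ← EReal.coe_neg, EReal.exp_coe,
          ← ENNReal.ofReal_pow (Real.exp_pos _).le, ← Real.exp_nat_mul]
        refine ENNReal.ofReal_le_ofReal (Real.exp_le_exp.2 ?_)
        have := le_max_left (h.φ y).toReal 0
        push_cast
        linarith
    _ ≤ (C₀ * h.nrm y (s y)) ^ 2 := by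
        gcongr ?_ ^ 2
        exact (hcmp y hyK _).1
    _ = _ := mul_pow _ _ _

end SingularMetric

/-! ### Fréchet spaces from seminorms. -/

section Frechet

open Filter Topology

/-- A separating family of seminorms with a countable cofinal subfamily, for which Cauchy sequences
converge, defines a Fréchet space. -/
theorem exists_isFrechetSpace_of_seminorms {E ι κ : Type*} [AddCommGroup E] [Module ℂ E]
    [Countable κ] (q : SeminormFamily ℂ E ι) (σ : κ → ι) (hσ : ∀ i, ∃ k, q i ≤ q (σ k))
    (hsep : ∀ f, (∀ i, q i f = 0) → f = 0)
    (hcomplete : ∀ u : ℕ → E, (∀ i, ∀ ε > 0, ∃ N, ∀ m ≥ N, ∀ k ≥ N, q i (u m - u k) < ε) →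
      ∃ f, ∀ i, Tendsto (fun m => q i (u m - f)) atTop (𝓝 0)) :
    ∃ _ : TopologicalSpace E, WithSeminorms q ∧ IsFrechetSpace E := by
  let _ : TopologicalSpace E := q.moduleFilterBasis.topology
  have hq : WithSeminorms q := ⟨rfl⟩
  -- The countable subfamily defines the same topology. This gives first countability, hence a
  -- countably generated uniformity, metrizability, and completeness tested on sequences.
  have hqσ : WithSeminorms (fun k => q (σ k)) := by
    refine hq.congr ?_ ?_
    · intro k
      exact ⟨{σ k}, 1, by simp [Seminorm.comp_id]⟩
    · intro i
      obtain ⟨k, hk⟩ := hσ i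
      exact ⟨{k}, 1, by simpa [Seminorm.comp_id] using hk⟩
  have hgrp : IsTopologicalAddGroup E := hq.topologicalAddGroup
  have hT1 : T1Space E := hq.T1_of_separating fun f hf => by
    by_contra! hcon
    exact hf (hsep f hcon)
  let _ : UniformSpace E := IsTopologicalAddGroup.rightUniformSpace E
  have hu : IsUniformAddGroup E := isUniformAddGroup_of_addCommGroup
  have hfc : FirstCountableTopology E := hqσ.firstCountableTopology
  have hcg : (uniformity E).IsCountablyGenerated := IsUniformAddGroup.uniformity_countably_generated
  refine ⟨_, hq, hgrp, hq.continuousSMul, hq.toLocallyConvexSpace, inferInstance,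
    UniformSpace.metrizableSpace, ?_⟩
  refine UniformSpace.complete_of_cauchySeq_tendsto fun v hv => ?_
  obtain ⟨f, hf⟩ := hcomplete v fun i ε hε => by
    have h1 : (fun z : E × E => z.2 - z.1) ⁻¹' (q i).ball 0 ε ∈ uniformity E := by
      rw [uniformity_eq_comap_nhds_zero]
      exact preimage_mem_comap (hq.mem_nhds_iff 0 _ |>.2 ⟨{i}, ε, hε, by simp⟩)
    obtain ⟨N, hN⟩ := (cauchySeq_iff.1 hv) _ h1
    refine ⟨N, fun m hm k hk => ?_⟩
    have := hN k hk m hm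
    simpa [Seminorm.mem_ball_zero] using this
  refine ⟨f, (hq.tendsto_nhds v f).2 fun i ε hε => ?_⟩
  exact (hf i).eventually_lt_const hε

end Frechet

/-! ### L²-seminorms and completeness of the spaces of sections. -/

namespace SingularMetric

open Metric Filter Topology

variable {n : ℕ} {X : Type*} [TopologicalSpace X] [ChartedSpace (Cn n) X]
  {F : X → Type*} [TopologicalSpace (Bundle.TotalSpace ℂ F)] [∀ x, TopologicalSpace (F x)]
  [∀ x, AddCommGroup (F x)] [∀ x, Module ℂ (F x)] [FiberBundle ℂ F] [VectorBundle ℂ ℂ F]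
  [MeasurableSpace X] {μ : Measure X} (h : SingularMetric n F μ)
  [IsManifold 𝓘(ℂ, Cn n) ω X] [ContMDiffVectorBundle ω ℂ F 𝓘(ℂ, Cn n)]
  [BorelSpace X] [T2Space X] [LocallyCompactSpace X]

/-- The `L²`-seminorm with respect to `h` over a relatively compact subset `K` of `U`. -/
def l2Seminorm {U : Set X} (hU : IsOpen U) {K : Set X} (hK : IsCompact (closure K))
    (hKU : closure K ⊆ U) : Seminorm ℂ (h.sections U) :=
  Seminorm.of
    -- Real exponents match Minkowski's inequality `ENNReal.lintegral_Lp_add_le`; `toReal` loses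
    -- nothing because the integral is finite.
    (fun s => ((∫⁻ x in K, h.nrm x ((s : ∀ x, F x) x) ^ (2 : ℝ) ∂μ) ^ (1 / (2 : ℝ))).toReal)
    (fun s t => by
      have hm : ∀ s : h.sections U,
          AEMeasurable (fun x => h.nrm x ((s : ∀ x, F x) x)) (μ.restrict K) := fun s =>
        (aemeasurable_nrm hU s.2).mono_set (subset_closure.trans hKU)
      have hfin : ∀ s : h.sections U,
          (∫⁻ x in K, h.nrm x ((s : ∀ x, F x) x) ^ (2 : ℝ) ∂μ) ^ (1 / (2 : ℝ)) ≠ ⊤ := fun s =>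
        ENNReal.rpow_ne_top_of_nonneg (by norm_num) (by
          simpa using (lintegral_nrm_sq_lt_top hU s.2 hK hKU).ne)
      rw [← ENNReal.toReal_add (hfin s) (hfin t)]
      refine ENNReal.toReal_mono (ENNReal.add_ne_top.2 ⟨hfin s, hfin t⟩) ?_
      refine le_trans ?_ (ENNReal.lintegral_Lp_add_le (hm s) (hm t) one_le_two)
      gcongr with x
      exact h.nrm_add_le x _ _)
    (fun a s => by
      have h1 : ∀ x, h.nrm x (((a • s : h.sections U) : ∀ x, F x) x) ^ (2 : ℝ) =
          ‖a‖ₑ ^ (2 : ℝ) * h.nrm x ((s : ∀ x, F x) x) ^ (2 : ℝ) := fun x => by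
        rw [← ENNReal.mul_rpow_of_nonneg _ _ (by norm_num), ← h.nrm_smul]
        rfl
      simp_rw [h1]
      rw [lintegral_const_mul' _ _ (by finiteness), ENNReal.mul_rpow_of_nonneg _ _ (by norm_num),
        ← ENNReal.rpow_mul, ENNReal.toReal_mul]
      norm_num)

theorem ofReal_l2Seminorm_sq {U : Set X} (hU : IsOpen U) {K : Set X} (hK : IsCompact (closure K))
    (hKU : closure K ⊆ U) (s : h.sections U) :
    ENNReal.ofReal (h.l2Seminorm hU hK hKU s ^ 2) =
      ∫⁻ x in K, h.nrm x ((s : ∀ x, F x) x) ^ 2 ∂μ := by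
  have hfin := (lintegral_nrm_sq_lt_top hU s.2 hK hKU).ne
  change ENNReal.ofReal (((∫⁻ x in K, h.nrm x ((s : ∀ x, F x) x) ^ (2 : ℝ) ∂μ) ^
    (1 / (2 : ℝ))).toReal ^ 2) = _
  simp only [ENNReal.rpow_ofNat]
  rw [ENNReal.ofReal_pow ENNReal.toReal_nonneg, ENNReal.ofReal_toReal
    (ENNReal.rpow_ne_top_of_nonneg (by norm_num) hfin), ← ENNReal.rpow_mul_natCast]
  norm_num

omit [LocallyCompactSpace X] in
variable {h} in
/-- The coordinates of an `L²_loc`-Cauchy sequence of sections are locally uniformly Cauchy. -/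
theorem exists_uniformCauchySeqOn_coord (hμ : IsSmoothVolume n μ) {U : Set X} (hU : IsOpen U)
    {s : ℕ → ∀ x, F x} (hs : ∀ m, s m ∈ h.sections U)
    (hcauchy : ∀ K, IsCompact K → K ⊆ U → ∀ ε : ℝ≥0∞, 0 < ε → ∃ N, ∀ m ≥ N, ∀ k ≥ N,
      ∫⁻ x in K, h.nrm x (s m x - s k x) ^ 2 ∂μ ≤ ε)
    (e : Bundle.Trivialization ℂ (Bundle.TotalSpace.proj : Bundle.TotalSpace ℂ F → X))
    [MemTrivializationAtlas e] {x₀ : X} (hx₀ : x₀ ∈ U) (hx₀e : x₀ ∈ e.baseSet) :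
    ∃ W ∈ 𝓝 x₀, W ⊆ U ∩ e.baseSet ∧
      UniformCauchySeqOn (fun m x => e.linearMapAt ℂ x (s m x)) atTop W := by
  obtain ⟨W, hW, hWU, K, hK, hKU, C, hC, hle⟩ := h.exists_enorm_sq_coord_le hμ hU e hx₀ hx₀e
  refine ⟨W, hW, hWU, ?_⟩
  rw [Metric.uniformCauchySeqOn_iff]
  intro ε hε
  -- After multiplication by C the bound is ε²/2 < ε². If C = 0 the quotient is ⊤, which `hcauchy`
  -- admits.
  obtain ⟨N, hN⟩ := hcauchy K hK hKU (ENNReal.ofReal (ε ^ 2 / 2) / C)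
    (ENNReal.div_pos (by simpa using by positivity) hC)
  refine ⟨N, fun m hm k hk x hx => ?_⟩
  have h1 := (hle _ ((h.sections U).sub_mem (hs m) (hs k)) x hx).trans
    ((mul_le_mul_right (hN m hm k hk) C).trans ENNReal.mul_div_le)
  rw [Pi.sub_apply, map_sub, ← ofReal_norm, ← ENNReal.ofReal_pow (norm_nonneg _),
    ENNReal.ofReal_le_ofReal_iff (by positivity)] at h1
  rw [dist_eq_norm]
  exact lt_of_pow_lt_pow_left₀ 2 hε.le (by linarith [pow_pos hε 2])

variable {h} in
/-- The space of sections of `F ⊗ 𝓘(h)` over `U` is complete for `L²_loc`-convergence. -/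
theorem exists_section_limit (hμ : IsSmoothVolume n μ) {U : Set X} (hU : IsOpen U)
    {s : ℕ → ∀ x, F x} (hs : ∀ m, s m ∈ h.sections U)
    (hcauchy : ∀ K, IsCompact K → K ⊆ U → ∀ ε : ℝ≥0∞, 0 < ε → ∃ N, ∀ m ≥ N, ∀ k ≥ N,
      ∫⁻ x in K, h.nrm x (s m x - s k x) ^ 2 ∂μ ≤ ε) :
    ∃ t ∈ h.sections U, ∀ K, IsCompact K → K ⊆ U → ∀ ε : ℝ≥0∞, 0 < ε → ∃ N, ∀ m ≥ N,
      ∫⁻ x in K, h.nrm x (s m x - t x) ^ 2 ∂μ ≤ ε := by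
  have hunif := fun (e : Bundle.Trivialization ℂ
      (Bundle.TotalSpace.proj : Bundle.TotalSpace ℂ F → X)) [MemTrivializationAtlas e] (x₀ : X)
      (hx₀ : x₀ ∈ U ∩ e.baseSet) => exists_uniformCauchySeqOn_coord hμ hU hs hcauchy e hx₀.1 hx₀.2
  choose t ht0 ht using exists_tendsto_coord fun e _ x hx => by
    obtain ⟨W, hW, -, hWc⟩ := hunif e x hx
    exact hWc.cauchySeq (mem_of_mem_nhds hW)
  have hhol : ∀ (e : Bundle.Trivialization ℂ
      (Bundle.TotalSpace.proj : Bundle.TotalSpace ℂ F → X)) [MemTrivializationAtlas e],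
      HolomorphicOn n (fun x => e.linearMapAt ℂ x (t x)) (U ∩ e.baseSet) := by
    intro e _ x₀ hx₀
    obtain ⟨W, hW, hWU, hWc⟩ := hunif e x₀ hx₀
    set c := chartAt (Cn n) x₀
    have hcm : c ∈ IsManifold.maximalAtlas 𝓘(ℂ, Cn n) ω X := IsManifold.chart_mem_maximalAtlas x₀
    have hx₀c : x₀ ∈ c.source := mem_chart_source _ x₀
    refine (mdifferentiableAt_of_differentiableAt_comp_symm hcm hx₀c ?_).mdifferentiableWithinAt
    have hO : c.target ∩ c.symm ⁻¹' interior W ∈ 𝓝 (c x₀) :=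
      (c.isOpen_inter_preimage_symm isOpen_interior).mem_nhds
        ⟨c.map_source hx₀c, by
          simpa [c.left_inv hx₀c] using mem_interior_iff_mem_nhds.2 hW⟩
    obtain ⟨r, hr, hrO⟩ := Metric.mem_nhds_iff.1 hO
    have hW' : ∀ z ∈ ball (c x₀) r, c.symm z ∈ W := fun z hz => interior_subset (hrO hz).2
    refine differentiableAt_of_uniformCauchySeqOn hr
      (f := fun m => (fun x => e.linearMapAt ℂ x (s m x)) ∘ c.symm) (fun m => ?_) ?_ ?_
    · exact (((hs m).2 e).1.differentiableOn_comp_symm hcm).mono fun z hz =>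
        ⟨(hrO hz).1, hWU (hW' z hz)⟩
    · exact (hWc.comp c.symm).mono hW'
    · exact fun z hz => ht _ e (hWU (hW' z hz))
  -- Only almost everywhere: where e^{-φ} = ⊤, multiplication by it is not continuous at 0.
  have hnrm : ∀ m, ∀ᵐ x ∂μ, x ∈ U → Tendsto (fun k => h.nrm x (s m x - s k x) ^ 2) atTop
      (𝓝 (h.nrm x (s m x - t x) ^ 2)) := by
    intro m
    filter_upwards [h.ae_finite] with x hx hxU
    have hxe := FiberBundle.mem_baseSet_trivializationAt' (F := ℂ) (E := F) x
    simp_rw [h.nrm_eq_mul (trivializationAt ℂ F x) hxe, map_sub]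
    refine ENNReal.Tendsto.pow (ENNReal.Tendsto.const_mul (ENNReal.Tendsto.mul_const ?_ ?_)
      (Or.inr ENNReal.ofReal_ne_top))
    · exact ((ht x (trivializationAt ℂ F x) ⟨hxU, hxe⟩).const_sub _).enorm
    · right
      rw [← EReal.coe_toReal hx.1 hx.2, ← EReal.coe_neg, EReal.exp_coe]
      exact ENNReal.ofReal_ne_top
  have hlim : ∀ K, IsCompact K → K ⊆ U → ∀ ε : ℝ≥0∞, 0 < ε → ∃ N, ∀ m ≥ N,
      ∫⁻ x in K, h.nrm x (s m x - t x) ^ 2 ∂μ ≤ ε := by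
    intro K hK hKU ε hε
    obtain ⟨N, hN⟩ := hcauchy K hK hKU ε hε
    refine ⟨N, fun m hm => ?_⟩
    have hmeas : ∀ k, AEMeasurable (fun x => h.nrm x (s m x - s k x) ^ 2) (μ.restrict K) := fun k =>
      ((aemeasurable_nrm hU ((h.sections U).sub_mem (hs m) (hs k))).mono_set hKU).pow_const 2
    -- Fatou's lemma in k, with m fixed.
    calc ∫⁻ x in K, h.nrm x (s m x - t x) ^ 2 ∂μ
        = ∫⁻ x in K, liminf (fun k => h.nrm x (s m x - s k x) ^ 2) atTop ∂μ := by
          refine lintegral_congr_ae ?_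
          filter_upwards [ae_restrict_of_ae (hnrm m), ae_restrict_mem hK.measurableSet] with x hx hxK
          exact (hx (hKU hxK)).liminf_eq.symm
      _ ≤ liminf (fun k => ∫⁻ x in K, h.nrm x (s m x - s k x) ^ 2 ∂μ) atTop :=
          lintegral_liminf_le' hmeas
      _ ≤ ε := liminf_le_of_le (h := fun b hb => by
          obtain ⟨k, hk, hkN⟩ := (hb.and (eventually_ge_atTop N)).exists
          exact hk.trans (hN m hm k hkN))
  refine ⟨t, ⟨fun x hx => ht0 x hx, fun e _ => ⟨hhol e, fun K hK hKU => ?_⟩⟩, hlim⟩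
  have hKU' : K ⊆ U := hKU.trans inter_subset_left
  -- One term at finite L²-distance from t suffices, by |t|² ≤ 2(|s_N|² + |s_N - t|²).
  obtain ⟨N, hN⟩ := hlim K hK hKU' 1 one_pos
  obtain ⟨C, hC, hcmp⟩ := h.exists_nrm_comparable e hK (hKU.trans inter_subset_right)
  have hfin := lintegral_nrm_sq_lt_top hU (hs N) (K := K) (by rwa [hK.isClosed.closure_eq])
    (by rwa [hK.isClosed.closure_eq])
  have hmeas : AEMeasurable (fun x => h.nrm x (s N x) ^ 2) (μ.restrict K) :=
    ((aemeasurable_nrm hU (hs N)).mono_set hKU').pow_const 2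
  calc ∫⁻ x in K, (‖e.linearMapAt ℂ x (t x)‖ₑ * EReal.exp (-h.φ x)) ^ 2 ∂μ
      ≤ ∫⁻ x in K, C ^ 2 * (2 * (h.nrm x (s N x) ^ 2 + h.nrm x (s N x - t x) ^ 2)) ∂μ := by
        refine setLIntegral_mono' hK.measurableSet fun x hx => ?_
        have h1 : h.nrm x (t x) ≤ h.nrm x (s N x) + h.nrm x (s N x - t x) := by
          have h2 := h.nrm_add_le x (s N x) ((-1 : ℂ) • (s N x - t x))
          rw [h.nrm_smul] at h2
          simpa using h2
        have h3 := ENNReal.rpow_add_le_mul_rpow_add_rpow (h.nrm x (s N x))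
          (h.nrm x (s N x - t x)) (p := 2) (by norm_num)
        norm_num at h3
        calc _ ≤ (C * h.nrm x (t x)) ^ 2 := by
              gcongr ?_ ^ 2
              exact (hcmp x hx _).1
          _ ≤ _ := by
              rw [mul_pow]
              gcongr
              exact (pow_le_pow_left' h1 2).trans h3
    _ = C ^ 2 * (2 * (∫⁻ x in K, h.nrm x (s N x) ^ 2 ∂μ +
          ∫⁻ x in K, h.nrm x (s N x - t x) ^ 2 ∂μ)) := by
        rw [lintegral_const_mul' _ _ (by finiteness), lintegral_const_mul' _ _ (by finiteness),
          lintegral_add_left' hmeas]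
    _ < ⊤ := ENNReal.mul_lt_top (by finiteness) (ENNReal.mul_lt_top (by finiteness)
        (ENNReal.add_lt_top.2 ⟨hfin, (hN N le_rfl).trans_lt ENNReal.one_lt_top⟩))

end SingularMetric

/-- An open subset of a second countable locally compact Hausdorff space has a countable cofinal
family of compact subsets. -/
theorem exists_compact_exhaustion {X : Type*} [TopologicalSpace X] [T2Space X]
    [LocallyCompactSpace X] [SecondCountableTopology X] {U : Set X} (hU : IsOpen U) :
    ∃ K : ℕ → Set X, (∀ j, IsCompact (K j) ∧ K j ⊆ U) ∧
      ∀ L, IsCompact L → L ⊆ U → ∃ j, L ⊆ K j := by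
  have := hU.locallyCompactSpace
  let E : CompactExhaustion U := default
  refine ⟨fun j => (↑) '' E j, fun j => ⟨(E.isCompact j).image continuous_subtype_val, ?_⟩, ?_⟩
  · rintro _ ⟨x, -, rfl⟩
    exact x.2
  · intro L hL hLU
    have hL' : IsCompact ((↑) ⁻¹' L : Set U) := by
      rw [Subtype.isCompact_iff, Subtype.image_preimage_coe, inter_eq_right.2 hLU]
      exact hL
    obtain ⟨j, hj⟩ := E.exists_superset_of_isCompact hL'
    exact ⟨j, fun x hx => ⟨⟨x, hLU hx⟩, hj hx, rfl⟩⟩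

/-! ### Separation, and the seminorms on Čech cochains. -/

namespace SingularMetric

open Filter Topology

variable {n : ℕ} {X : Type*} [TopologicalSpace X] [ChartedSpace (Cn n) X]
  {F : X → Type*} [TopologicalSpace (Bundle.TotalSpace ℂ F)] [∀ x, TopologicalSpace (F x)]
  [∀ x, AddCommGroup (F x)] [∀ x, Module ℂ (F x)] [FiberBundle ℂ F] [VectorBundle ℂ ℂ F]
  [MeasurableSpace X] {μ : Measure X} (h : SingularMetric n F μ)
  [IsManifold 𝓘(ℂ, Cn n) ω X] [ContMDiffVectorBundle ω ℂ F 𝓘(ℂ, Cn n)]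
  [BorelSpace X] [T2Space X]

variable {h} in
-- The local sup bound makes the coordinate vanish at every point of U, not merely almost
-- everywhere. This is the Hausdorff property.
theorem eq_zero_of_lintegral_nrm_sq_eq_zero (hμ : IsSmoothVolume n μ) {U : Set X} (hU : IsOpen U)
    {s : ∀ x, F x} (hs : s ∈ h.sections U)
    (h0 : ∀ K, IsCompact K → K ⊆ U → ∫⁻ x in K, h.nrm x (s x) ^ 2 ∂μ = 0) : s = 0 := by
  funext x
  by_cases hx : x ∈ U
  · have hxe := FiberBundle.mem_baseSet_trivializationAt' (F := ℂ) (E := F) x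
    obtain ⟨W, hW, -, K, hK, hKU, C, -, hle⟩ :=
      h.exists_enorm_sq_coord_le hμ hU (trivializationAt ℂ F x) hx hxe
    have h1 := hle s hs x (mem_of_mem_nhds hW)
    rw [h0 K hK hKU, mul_zero] at h1
    rw [eq_linearMapAt_smul_trivFrame (trivializationAt ℂ F x) hxe (s x)]
    simp at h1
    simp [h1]
  · exact hs.1 x hx

variable [LocallyCompactSpace X] {ι : Type*} {B : ι → Set X} {p : ℕ}

/-- The component `f_{i₀…i_p}` of a cochain, as a linear map. -/
def Cochain.proj (i : Fin (p + 1) → ι) : h.Cochain B p →ₗ[ℂ] h.sections (⋂ k, B (i k)) where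
  toFun f := f i
  map_add' _ _ := rfl
  map_smul' _ _ := rfl

/-- The seminorms `p_K` on the space of Čech cochains. -/
def cochainSeminorm (hB : ∀ i, IsOpen (B i)) : SeminormFamily ℂ (h.Cochain B p) (RelCompactIn B p) :=
  fun K => (h.l2Seminorm (isOpen_iInter_of_finite fun k => hB (K.idx k)) K.isCompact_closure
    K.closure_subset).comp (Cochain.proj h K.idx)

theorem ofReal_cochainSeminorm_sq (hB : ∀ i, IsOpen (B i)) (K : RelCompactIn B p)
    (f : h.Cochain B p) :
    ENNReal.ofReal (h.cochainSeminorm hB K f ^ 2) =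
      ∫⁻ x in K.K, h.nrm x (f.val K.idx x) ^ 2 ∂μ :=
  h.ofReal_l2Seminorm_sq (isOpen_iInter_of_finite fun k => hB (K.idx k)) K.isCompact_closure
    K.closure_subset (f K.idx)

theorem cochainSeminorm_le_iff (hB : ∀ i, IsOpen (B i)) (K : RelCompactIn B p)
    (f : h.Cochain B p) {ε : ℝ} (hε : 0 ≤ ε) :
    h.cochainSeminorm hB K f ≤ ε ↔
      ∫⁻ x in K.K, h.nrm x (f.val K.idx x) ^ 2 ∂μ ≤ ENNReal.ofReal (ε ^ 2) := by
  rw [← h.ofReal_cochainSeminorm_sq hB, ENNReal.ofReal_le_ofReal_iff (by positivity),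
    sq_le_sq₀ (apply_nonneg _ _) hε]

theorem cochainSeminorm_mono (hB : ∀ i, IsOpen (B i)) {K L : RelCompactIn B p}
    (hidx : K.idx = L.idx) (hKL : K.K ⊆ L.K) : h.cochainSeminorm hB K ≤ h.cochainSeminorm hB L := by
  intro f
  rw [h.cochainSeminorm_le_iff hB K f (apply_nonneg _ _), h.ofReal_cochainSeminorm_sq hB, hidx]
  exact lintegral_mono_set hKL

end SingularMetric

/-- A compact subset of `B_{i₀…i_p}`. -/
def RelCompactIn.ofCompact {X : Type*} [TopologicalSpace X] [T2Space X] [MeasurableSpace X]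
    [BorelSpace X] {ι : Type*} {B : ι → Set X} {p : ℕ} (i : Fin (p + 1) → ι) {K : Set X}
    (hK : IsCompact K) (hKB : K ⊆ ⋂ k, B (i k)) : RelCompactIn B p where
  idx := i
  K := K
  measurableSet := hK.measurableSet
  isCompact_closure := by rwa [hK.isClosed.closure_eq]
  closure_subset := by rwa [hK.isClosed.closure_eq]

end CechFrechet

end

theorem mainTheorem6 {n : ℕ} {X : Type*} [TopologicalSpace X] [CompactSpace X] [T2Space X]
    [ChartedSpace (CechFrechet.Cn n) X] [IsManifold 𝓘(ℂ, CechFrechet.Cn n) ω X]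
    [MeasurableSpace X] [BorelSpace X]
    (μ : Measure X) (hμ : CechFrechet.IsSmoothVolume n μ)
    {F : X → Type*} [TopologicalSpace (Bundle.TotalSpace ℂ F)] [∀ x, TopologicalSpace (F x)]
    [∀ x, AddCommGroup (F x)] [∀ x, Module ℂ (F x)] [FiberBundle ℂ F] [VectorBundle ℂ ℂ F]
    [ContMDiffVectorBundle ω ℂ F 𝓘(ℂ, CechFrechet.Cn n)]
    (h : CechFrechet.SingularMetric n F μ)
    (hcurv : ∃ γ : CechFrechet.RealOneOneForm n X, h.CurvatureGE γ)
    {ι : Type*} [Finite ι] (B : ι → Set X) (hcover : ⋃ i, B i = Set.univ)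
    (hStein : ∀ i, CechFrechet.IsSteinOpen n (B i))
    (htriv : ∀ i, ∃ s : ∀ x, F x, CechFrechet.IsHolomorphicFrame n s (B i))
    (hgen : ∀ i, ∃ (N : ℕ) (G : Fin N → X → ℂ), h.GeneratesStalks (B i) G)
    (p : ℕ) :
    ∃ q : SeminormFamily ℂ (h.Cochain B p) (CechFrechet.RelCompactIn B p),
      (∀ (K : CechFrechet.RelCompactIn B p) (f : h.Cochain B p),
        ENNReal.ofReal (q K f ^ 2) = ∫⁻ x in K.K, h.nrm x (f.val K.idx x) ^ 2 ∂μ) ∧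
      ∃ t : TopologicalSpace (h.Cochain B p),
        WithSeminorms q ∧ CechFrechet.IsFrechetSpace (h.Cochain B p) := by
  have hB : ∀ i, IsOpen (B i) := fun i => (hStein i).isOpen
  have hU : ∀ i : Fin (p + 1) → ι, IsOpen (⋂ k, B (i k)) := fun i =>
    isOpen_iInter_of_finite fun k => hB (i k)
  have : SecondCountableTopology X := ChartedSpace.secondCountable_of_sigmaCompact (CechFrechet.Cn n) X
  choose K hK hKcof using fun i : Fin (p + 1) → ι => CechFrechet.exists_compact_exhaustion (hU i)
  refine ⟨h.cochainSeminorm hB, h.ofReal_cochainSeminorm_sq hB,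
    -- The cofinal family is indexed by tuples and exhaustion steps; it is countable because `ι` is
    -- finite.
    CechFrechet.exists_isFrechetSpace_of_seminorms _ (κ := (Fin (p + 1) → ι) × ℕ)
      (fun a => .ofCompact a.1 (hK a.1 a.2).1 (hK a.1 a.2).2) ?_ ?_ ?_⟩
  · intro L
    obtain ⟨j, hj⟩ := hKcof L.idx _ L.isCompact_closure L.closure_subset
    exact ⟨(L.idx, j), h.cochainSeminorm_mono hB rfl (subset_closure.trans hj)⟩
  · intro f hf
    funext i
    refine Subtype.ext (CechFrechet.SingularMetric.eq_zero_of_lintegral_nrm_sq_eq_zero hμ (hU i) (f i).2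
      fun L hL hLU => ?_)
    have := h.ofReal_cochainSeminorm_sq hB (.ofCompact i hL hLU) f
    rw [hf, zero_pow two_ne_zero, ENNReal.ofReal_zero] at this
    exact this.symm
  · intro u hu
    -- Each seminorm sees a single component, so limits are taken component by component, with no
    -- uniformity in i.
    have hlim : ∀ i : Fin (p + 1) → ι, _ := fun i =>
      CechFrechet.SingularMetric.exists_section_limit (h := h) hμ (hU i) (s := fun m => (u m i : ∀ x, F x))
        (fun m => (u m i).2) fun L hL hLU ε hε => by
          obtain ⟨δ, hδ, hδε⟩ : ∃ δ : ℝ, 0 < δ ∧ ENNReal.ofReal (δ ^ 2) ≤ ε := by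
            -- ε may be ⊤, so it is capped at 1 before a real square root is taken.
            have hfin : min ε 1 ≠ ⊤ := (min_lt_of_right_lt ENNReal.one_lt_top).ne
            refine ⟨√(min ε 1).toReal,
              Real.sqrt_pos.2 (ENNReal.toReal_pos (lt_min hε one_pos).ne' hfin), ?_⟩
            rw [Real.sq_sqrt ENNReal.toReal_nonneg, ENNReal.ofReal_toReal hfin]
            exact min_le_left _ _
          obtain ⟨N, hN⟩ := hu (.ofCompact i hL hLU) δ hδ
          refine ⟨N, fun m hm k hk => le_trans ?_ hδε⟩
          exact (h.cochainSeminorm_le_iff hB (.ofCompact i hL hLU) (u m - u k) hδ.le).1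
            (hN m hm k hk).le
    choose t ht htlim using hlim
    refine ⟨fun i => ⟨t i, ht i⟩, fun L => ?_⟩
    rw [Metric.tendsto_atTop]
    intro ε hε
    obtain ⟨N, hN⟩ := htlim L.idx _ L.isCompact_closure L.closure_subset
      (ENNReal.ofReal ((ε / 2) ^ 2)) (by simpa using by positivity)
    refine ⟨N, fun m hm => ?_⟩
    rw [Real.dist_0_eq_abs, abs_of_nonneg (apply_nonneg _ _)]
    refine lt_of_le_of_lt ((h.cochainSeminorm_le_iff hB L _ (by positivity : 0 ≤ ε / 2)).2 ?_)
      (by linarith)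
    exact (lintegral_mono_set subset_closure).trans (hN m hm)
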